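/- Notation. For a vector or matrix, $|\cdot|$ is the entrywise magnitude, $\preceq$ is the entrywise order, and $\max$, $\lim$, $\limsup$ are taken entrywise. $\rho(\cdot)$ is the spectral radius; a real matrix is Hurwitz if all its eigenvalues have negative real part; $M'$ is the transpose and $M^*$ the conjugate transpose of $M$; $M>0$ ($M<0$) means that the real symmetric matrix $M$ is positive (negative) definite. A function $f:\mathbb{R}^n_{\ge 0}\to\mathbb{R}^m_{\ge 0}$ is called CNI if $0\preceq x\preceq y$ implies $f(x)\preceq f(y)$. Setting. Let $N\ge 1$, $\bar\tau\ge 0$ and, for $i\in\{1,\dots,N\}$, let $A_i\in\mathbb{R}^{n\times n}$, $H_i\in\mathbb{R}^{n\times k_i}$, and let $\delta_i:\mathbb{R}^n_{\ge 0}\to\mathbb{R}^{k_i}_{\ge 0}$ be continuous and CNI. A trajectory is a continuous function $x:[-\bar\tau,\infty)\to\mathbb{R}^n$ for which there are a switching function $\sigma:[0,\infty)\to\{1,\dots,N\}$ and perturbations $w_i:[0,\infty)\to\mathbb{R}^{k_i}$ such that $$\dot x(t)=A_{\sigma(t)}x(t)+H_{\sigma(t)}w_{\sigma(t)}(t)\quad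 (t\ge 0)$$ in the sense of Carathéodory (the right-hand side is locally integrable on $[0,\infty)$ and $x(t)=x(0)+\int_0^t (A_{\sigma(s)}x(s)+H_{\sigma(s)}w_{\sigma(s)}(s))\,ds$), and $$|w_i(t)|\preceq\delta_i(\theta(t)),\qquad \theta(t)=\max_{t-\bar\tau\le s\le t}|x(s)|,\qquad\text{for all } t\ge 0 \text{ and all } i.$$ Let $V\in\mathbb{C}^{n\times n}$ be invertible. For $M\in\mathbb{C}^{n\times n}$ let $\mathcal{M}(M)$ be the real matrix with diagonal entries $\operatorname{Re}M_{jj}$ and off-diagonal entries $|M_{jk}|$, and let $\Lambda=\max_i\mathcal{M}(V^{-1}A_iV)$. Put $$\psi(x)=\max_i\ \max_{|w|\preceq\delta_i(|V|x)}|V^{-1}H_iw|,\qquad x\in\mathbb{R}^n_{\ge 0}.$$ Theorem. Suppose that $\Lambda$ is Hurwitz, that $\bar F\in\mathbb{R}^{n\times n}$ and $\bar w\in\mathbb{R}^n$ have nonnegative entries and satisfy $\psi(x)\preceq\bar Fx+\bar w$ for all $x\in\mathbb{R}^n_{\ge 0}$, and that $\rho(R)<1$, where $R=-\Lambda^{-1}\bar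 F$. Then $I-R$ is invertible, $\tilde b=(I-R)^{-1}(-\Lambda^{-1})\bar w\succeq 0$, and: (a) For every trajectory, if $|V^{-1}x(t)|\preceq\tilde b$ for $-\bar\tau\le t\le 0$, then $|V^{-1}x(t)|\preceq\tilde b$ for all $t\ge-\bar\tau$. (b) For every trajectory, $\limsup_{t\to\infty}|V^{-1}x(t)|\preceq\tilde b$. (c) Let $\delta:\mathbb{R}^n_{\ge 0}\to\mathbb{R}^n_{\ge 0}$ be continuous and CNI with $\psi(x)\preceq\delta(x)\preceq\bar Fx+\bar w$ for all $x\in\mathbb{R}^n_{\ge 0}$, and let $T_0(x)=-\Lambda^{-1}\delta(x)$. Then $b=\lim_{k\to\infty}T_0^k(\tilde b)$ exists, $b\preceq\tilde b$, and $\limsup_{t\to\infty}|V^{-1}x(t)|\preceq b$ for every trajectory. (d) There is a diagonal matrix $D>0$ such that $(\Lambda+\bar F)'D+D(\Lambda+\bar F)<0$. (e) Suppose that $\bar\tau=0$, let $D$ be any matrix as in (d), and let $L(x)=x'Px$ with $P=\operatorname{Re}\{(V^{-1})^*DV^{-1}\}$. Then the derivative of $L$ along trajectories is negative wherever the state is large: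 there is $r$ such that - for all $i$, all $x\in\mathbb{R}^n$ with $\|x\|>r$ and all $w\in\mathbb{R}^{k_i}$ with $|w|\preceq\delta_i(|x|)$, $\;x'(A_i'P+PA_i)x+2x'PH_iw<0$; - for every trajectory and every $t\ge 0$ with $\|x(t)\|>r$, the upper right Dini derivative of $s\mapsto L(x(s))$ at $t$ is negative. -/

import Mathlib

open Filter Topology MeasureTheory
open scoped Matrix

namespace SwitchSys

noncomputable section

/-- The real matrix or vector data, read as complex. -/
abbrev toC {m n : ℕ} (M : Matrix (Fin m) (Fin n) ℝ) : Matrix (Fin m) (Fin n) ℂ :=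
  M.map (fun a : ℝ => (a : ℂ))

/-- Entrywise magnitude of a complex matrix. -/
def absMat {m n : ℕ} (M : Matrix (Fin m) (Fin n) ℂ) : Matrix (Fin m) (Fin n) ℝ :=
  M.map (fun z : ℂ => ‖z‖)

/-- The vector `|M x|` of magnitudes, for a complex matrix `M` and a real vector `x`. -/
def absMulVec {m n : ℕ} (M : Matrix (Fin m) (Fin n) ℂ) (x : Fin n → ℝ) : Fin m → ℝ :=
  fun j => ‖(M *ᵥ (fun l => (x l : ℂ))) j‖

/-- The operation `𝓜`: real parts on the diagonal, magnitudes off the diagonal. -/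
def metzlerOf {n : ℕ} (M : Matrix (Fin n) (Fin n) ℂ) : Matrix (Fin n) (Fin n) ℝ :=
  Matrix.of fun i k => if i = k then (M i k).re else ‖M i k‖

/-- `Λ = max_i 𝓜(V⁻¹ A_i V)`, the maximum being taken entrywise. -/
def Lam {n N : ℕ} (A : Fin N → Matrix (Fin n) (Fin n) ℝ) (V : Matrix (Fin n) (Fin n) ℂ) :
    Matrix (Fin n) (Fin n) ℝ :=
  Matrix.of fun j k => ⨆ i : Fin N, metzlerOf (V⁻¹ * toC (A i) * V) j k

/-- All (complex) eigenvalues have negative real part. -/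
def IsHurwitz {n : ℕ} (M : Matrix (Fin n) (Fin n) ℝ) : Prop :=
  ∀ μ ∈ spectrum ℂ (toC M), μ.re < 0

/-- The spectral radius of a real matrix (over its complex eigenvalues). -/
def specRad {n : ℕ} (M : Matrix (Fin n) (Fin n) ℝ) : ENNReal :=
  spectralRadius ℂ (toC M)

/-- CNI functions `ℝⁿ₊₀ → ℝᵐ₊₀`: they map the nonnegative orthant to the nonnegative orthant and
preserve the componentwise order there. Values outside the orthant are irrelevant. -/
structure IsCNI {n m : ℕ} (f : (Fin n → ℝ) → (Fin m → ℝ)) : Prop where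
  nonneg : ∀ x, 0 ≤ x → 0 ≤ f x
  mono : ∀ x y, 0 ≤ x → x ≤ y → f x ≤ f y

/-- `θ(t) = max_{t-τ ≤ s ≤ t} |x(s)|`, componentwise. -/
def theta {n : ℕ} (τ : ℝ) (x : ℝ → Fin n → ℝ) (t : ℝ) : Fin n → ℝ :=
  fun j => sSup ((fun s => |x s j|) '' Set.Icc (t - τ) t)

/-- `ψ(x) = max_i max_{|w| ⪯ δ_i(|V|x)} |V⁻¹ H_i w|`, componentwise. -/
def psi {n N : ℕ} {k : Fin N → ℕ} (H : ∀ i, Matrix (Fin n) (Fin (k i)) ℝ)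
    (δ : ∀ i, (Fin n → ℝ) → (Fin (k i) → ℝ)) (V : Matrix (Fin n) (Fin n) ℂ)
    (x : Fin n → ℝ) : Fin n → ℝ :=
  fun j => ⨆ i : Fin N,
    sSup ((fun w : Fin (k i) → ℝ => absMulVec (V⁻¹ * toC (H i)) w j) ''
      {w | ∀ l, |w l| ≤ δ i (absMat V *ᵥ x) l})

/-- The right-hand side `A_{σ(t)} x(t) + H_{σ(t)} w_{σ(t)}(t)`. -/
def rhs {n N : ℕ} {k : Fin N → ℕ} (A : Fin N → Matrix (Fin n) (Fin n) ℝ)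
    (H : ∀ i, Matrix (Fin n) (Fin (k i)) ℝ) (σ : ℝ → Fin N)
    (w : ∀ i, ℝ → (Fin (k i) → ℝ)) (x : ℝ → Fin n → ℝ) (t : ℝ) : Fin n → ℝ :=
  A (σ t) *ᵥ x t + H (σ t) *ᵥ w (σ t) t

/-- `x`, with switching function `σ` and perturbations `w_i`, is a trajectory on `[-τ, ∞)` of the
switching system with perturbation bounds `δ_i` and maximal delay `τ`: it is continuous, solves
the differential equation for `t ≥ 0` in the sense of Carathéodory (that is, it is locally
absolutely continuous on `[0, ∞)` and satisfies the equation almost everywhere, written here in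
integral form), and the perturbations obey their bounds at all times `t ≥ 0`. -/
structure IsTrajectory {n N : ℕ} {k : Fin N → ℕ} (A : Fin N → Matrix (Fin n) (Fin n) ℝ)
    (H : ∀ i, Matrix (Fin n) (Fin (k i)) ℝ) (δ : ∀ i, (Fin n → ℝ) → (Fin (k i) → ℝ)) (τ : ℝ)
    (σ : ℝ → Fin N) (w : ∀ i, ℝ → (Fin (k i) → ℝ)) (x : ℝ → Fin n → ℝ) : Prop where
  cont : ContinuousOn x (Set.Ici (-τ))
  integrable : ∀ t, 0 ≤ t → IntervalIntegrable (rhs A H σ w x) volume 0 t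
  solves : ∀ t, 0 ≤ t → x t = x 0 + ∫ s in (0 : ℝ)..t, rhs A H σ w x s
  bound : ∀ i, ∀ t, 0 ≤ t → ∀ l, |w i t l| ≤ δ i (theta τ x t) l

/-- `limsup_{t → ∞} v(t) ⪯ b`, componentwise; the upper limits are taken in the extended reals, so
that this includes the boundedness of `v` from above for large times. -/
def LimsupLe {n : ℕ} (v : ℝ → Fin n → ℝ) (b : Fin n → ℝ) : Prop :=
  ∀ j, limsup (fun t => ((v t j : ℝ) : EReal)) atTop ≤ ((b j : ℝ) : EReal)

/-- `R = -Λ⁻¹ F`. -/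
def Rmat {n : ℕ} (Λ F : Matrix (Fin n) (Fin n) ℝ) : Matrix (Fin n) (Fin n) ℝ :=
  -Λ⁻¹ * F

/-- `b̃ = (I - R)⁻¹ (-Λ⁻¹) w̄`. -/
def bTilde {n : ℕ} (Λ F : Matrix (Fin n) (Fin n) ℝ) (wbar : Fin n → ℝ) : Fin n → ℝ :=
  (1 - Rmat Λ F)⁻¹ *ᵥ ((-Λ⁻¹) *ᵥ wbar)

/-- `T₀(x) = -Λ⁻¹ δ(x)`. -/
def Tzero {n : ℕ} (Λ : Matrix (Fin n) (Fin n) ℝ) (δ : (Fin n → ℝ) → (Fin n → ℝ))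
    (x : Fin n → ℝ) : Fin n → ℝ :=
  (-Λ⁻¹) *ᵥ δ x

/-- `D` is diagonal, positive definite, and `M' D + D M < 0`. -/
def IsDiagLyap {n : ℕ} (M D : Matrix (Fin n) (Fin n) ℝ) : Prop :=
  D.IsDiag ∧ D.PosDef ∧ (-(Mᵀ * D + D * M)).PosDef

/-- `P = Re{(V⁻¹)^* D V⁻¹}`. -/
def Pmat {n : ℕ} (V : Matrix (Fin n) (Fin n) ℂ) (D : Matrix (Fin n) (Fin n) ℝ) :
    Matrix (Fin n) (Fin n) ℝ :=
  ((V⁻¹)ᴴ * toC D * V⁻¹).map Complex.re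

/-- `L(x) = x' P x`. -/
def quadForm {n : ℕ} (P : Matrix (Fin n) (Fin n) ℝ) (x : Fin n → ℝ) : ℝ :=
  x ⬝ᵥ (P *ᵥ x)

/-- Upper right Dini derivative, in the extended reals. -/
def upperDini (f : ℝ → ℝ) (t : ℝ) : EReal :=
  limsup (fun h : ℝ => (((f (t + h) - f t) / h : ℝ) : EReal)) (𝓝[>] (0 : ℝ))

end

end SwitchSys

open SwitchSys

/-! ### Matrices with nonpositive off-diagonal entries -/

section ZMatrix

variable {ι : Type*} [Fintype ι]

/-- All off-diagonal entries are nonpositive. -/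
def IsZMatrix (C : Matrix ι ι ℝ) : Prop := ∀ i j, i ≠ j → C i j ≤ 0

/-- If `y ≥ 0` vanishes at `i`, then `(C y) i ≤ 0`. -/
theorem IsZMatrix.mulVec_nonpos_of_apply_eq_zero {C : Matrix ι ι ℝ} (hC : IsZMatrix C)
    {y : ι → ℝ} (hy : 0 ≤ y) {i : ι} (hi : y i = 0) : (C *ᵥ y) i ≤ 0 := by
  refine Finset.sum_nonpos fun j _ => ?_
  by_cases hij : i = j
  · subst hij; simp [hi]
  · exact mul_nonpos_of_nonpos_of_nonneg (hC i j hij) (hy j)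

theorem IsZMatrix.pos_of_nonneg {C : Matrix ι ι ℝ} (hC : IsZMatrix C) {η : ι → ℝ}
    (hη : 0 ≤ η) (hCη : ∀ i, 0 < (C *ᵥ η) i) (i : ι) : 0 < η i := by
  refine lt_of_le_of_ne (hη i) fun h => ?_
  exact absurd (hC.mulVec_nonpos_of_apply_eq_zero hη h.symm) (not_le.2 (hCη i))

/-- A Z-matrix that maps some positive vector to a positive vector is monotone. -/
theorem IsZMatrix.nonneg_of_mulVec_nonneg {C : Matrix ι ι ℝ} (hC : IsZMatrix C) {η : ι → ℝ}
    (hη : ∀ i, 0 < η i) (hCη : ∀ i, 0 < (C *ᵥ η) i) {x : ι → ℝ} (hx : 0 ≤ C *ᵥ x) : 0 ≤ x := by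
  by_contra hneg
  obtain ⟨i₀, hi₀⟩ : ∃ i, x i < 0 := by
    simpa [Pi.le_def] using hneg
  obtain ⟨j, -, hj⟩ := Finset.exists_min_image Finset.univ (fun i => x i / η i)
    ⟨i₀, Finset.mem_univ _⟩
  set m := -(x j / η j) with hm
  have hmpos : 0 < m := by
    have h1 := hj i₀ (Finset.mem_univ _)
    have h2 : x i₀ / η i₀ < 0 := div_neg_of_neg_of_pos hi₀ (hη i₀)
    simp only [hm]; linarith
  have hy : 0 ≤ x + m • η := by
    intro i
    have h1 := hj i (Finset.mem_univ _)
    have h2 : x j / η j * η i ≤ x i := by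
      rwa [← le_div_iff₀ (hη i)]
    simp only [Pi.zero_apply, Pi.add_apply, Pi.smul_apply, smul_eq_mul, hm]; linarith
  have hyj : (x + m • η) j = 0 := by
    simp only [Pi.add_apply, Pi.smul_apply, smul_eq_mul, hm]
    field_simp [(hη j).ne']; ring
  have h1 := hC.mulVec_nonpos_of_apply_eq_zero hy hyj
  rw [Matrix.mulVec_add, Matrix.mulVec_smul] at h1
  have h2 := hx j
  have h3 := mul_pos hmpos (hCη j)
  simp only [Pi.zero_apply, Pi.add_apply, Pi.smul_apply, smul_eq_mul] at h1 h2
  linarith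

variable [DecidableEq ι]

theorem IsZMatrix.inv_nonneg {C : Matrix ι ι ℝ} (hC : IsZMatrix C) (hu : IsUnit C.det) {η : ι → ℝ}
    (hη : ∀ i, 0 < η i) (hCη : ∀ i, 0 < (C *ᵥ η) i) (i j : ι) : 0 ≤ C⁻¹ i j := by
  have h : 0 ≤ C⁻¹ *ᵥ Pi.single j 1 := by
    refine hC.nonneg_of_mulVec_nonneg hη hCη ?_
    rw [Matrix.mulVec_mulVec, Matrix.mul_nonsing_inv _ hu, Matrix.one_mulVec]
    intro k
    by_cases hk : k = j
    · subst hk; simp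
    · simp [hk]
  simpa using h i

/-- Along a continuous path of invertible Z-matrices, semipositivity is preserved. -/
theorem IsZMatrix.semipositive_of_path {C : ℝ → Matrix ι ι ℝ} (hcont : Continuous C) {T : ℝ}
    (hT : 0 ≤ T) (hC : ∀ u ∈ Set.Icc 0 T, IsZMatrix (C u))
    (hu : ∀ u ∈ Set.Icc 0 T, IsUnit (C u).det)
    {η : ι → ℝ} (hη : ∀ i, 0 < η i) (hCη : ∀ i, 0 < (C 0 *ᵥ η) i) :
    ∃ ζ : ι → ℝ, (∀ i, 0 < ζ i) ∧ C T *ᵥ ζ = 1 := by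
  have hone : ∀ u ∈ Set.Icc 0 T, C u *ᵥ ((C u)⁻¹ *ᵥ 1) = 1 := fun u hu' => by
    rw [Matrix.mulVec_mulVec, Matrix.mul_nonsing_inv _ (hu u hu'), Matrix.one_mulVec]
  have hcinv : ∀ u ∈ Set.Icc 0 T, ContinuousAt (fun v => (C v)⁻¹ *ᵥ (1 : ι → ℝ)) u := by
    intro u hu'
    have h1 : ContinuousAt (fun v => (C v)⁻¹) u := by
      refine ContinuousAt.comp (g := Inv.inv) ?_ hcont.continuousAt
      refine continuousAt_matrix_inv _ ?_
      have := (hu u hu').ne_zero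
      rw [Ring.inverse_eq_inv']
      exact continuousAt_inv₀ this
    have h2 : Continuous fun M : Matrix ι ι ℝ => M *ᵥ (1 : ι → ℝ) :=
      continuous_id.matrix_mulVec continuous_const
    exact h2.continuousAt.comp h1
  have hpos : ∀ u ∈ Set.Icc 0 T, 0 ≤ (C u)⁻¹ *ᵥ (1 : ι → ℝ) →
      ∀ i, 0 < ((C u)⁻¹ *ᵥ (1 : ι → ℝ)) i := fun u hu' h =>
    (hC u hu').pos_of_nonneg h fun i => by rw [hone u hu']; exact one_pos
  have hsub : Set.Icc 0 T ⊆ {u | 0 ≤ (C u)⁻¹ *ᵥ (1 : ι → ℝ)} := by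
    refine IsClosed.Icc_subset_of_forall_mem_nhdsWithin ?_ ?_ ?_
    · rw [Set.inter_comm]
      exact ContinuousOn.preimage_isClosed_of_isClosed
        (f := fun v => (C v)⁻¹ *ᵥ (1 : ι → ℝ))
        (fun u hu' => (hcinv u hu').continuousWithinAt) isClosed_Icc isClosed_Ici
    · have h0 : (0 : ℝ) ∈ Set.Icc 0 T := ⟨le_rfl, hT⟩
      refine (hC 0 h0).nonneg_of_mulVec_nonneg hη hCη ?_
      rw [hone 0 h0]; exact zero_le_one
    · rintro u ⟨hu1, hu2⟩
      have hu3 : u ∈ Set.Icc 0 T := ⟨hu2.1, hu2.2.le⟩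
      refine mem_nhdsWithin_of_mem_nhds ?_
      have : ∀ i, ∀ᶠ v in 𝓝 u, 0 < ((C v)⁻¹ *ᵥ (1 : ι → ℝ)) i := fun i =>
        (((continuous_apply i).continuousAt.comp (hcinv u hu3)).eventually
          (lt_mem_nhds (hpos u hu3 hu1 i)))
      filter_upwards [eventually_all.2 this] with v hv i using (hv i).le
  have hTm : T ∈ Set.Icc 0 T := ⟨hT, le_rfl⟩
  exact ⟨_, hpos T hTm (hsub hTm), hone T hTm⟩

end ZMatrix

/-! ### Spectral hypotheses -/

section Spectral

variable {n : ℕ}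

theorem isUnit_toC_iff (M : Matrix (Fin n) (Fin n) ℝ) : IsUnit (toC M) ↔ IsUnit M.det := by
  rw [Matrix.isUnit_iff_isUnit_det]
  have : (toC M).det = ((M.det : ℝ) : ℂ) := by
    have := RingHom.map_det Complex.ofRealHom M
    exact this.symm
  rw [this, isUnit_iff_ne_zero, isUnit_iff_ne_zero, Complex.ofReal_ne_zero]

theorem algebraMap_sub_toC (s : ℝ) (M : Matrix (Fin n) (Fin n) ℝ) :
    algebraMap ℂ (Matrix (Fin n) (Fin n) ℂ) (s : ℂ) - toC M
      = toC (s • (1 : Matrix (Fin n) (Fin n) ℝ) - M) := by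
  ext i j
  by_cases h : i = j
  · subst h; simp [Matrix.algebraMap_matrix_apply]
  · simp [Matrix.algebraMap_matrix_apply, h]

theorem SwitchSys.IsHurwitz.isUnit_det {M : Matrix (Fin n) (Fin n) ℝ} (hM : IsHurwitz M) {s : ℝ}
    (hs : 0 ≤ s) : IsUnit (s • (1 : Matrix (Fin n) (Fin n) ℝ) - M).det := by
  rw [← isUnit_toC_iff, ← algebraMap_sub_toC]
  by_contra h
  have := hM (s : ℂ) h
  simp at this
  linarith

theorem isUnit_det_one_sub_smul {R : Matrix (Fin n) (Fin n) ℝ} (hR : specRad R < 1) {u : ℝ}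
    (hu : u ∈ Set.Icc (0 : ℝ) 1) : IsUnit (1 - u • R).det := by
  rcases hu.1.eq_or_lt with rfl | hpos
  · simp
  have h1 : IsUnit (u⁻¹ • (1 : Matrix (Fin n) (Fin n) ℝ) - R).det := by
    rw [← isUnit_toC_iff, ← algebraMap_sub_toC]
    by_contra h
    have h2 : (‖((u⁻¹ : ℝ) : ℂ)‖₊ : ENNReal) ≤ specRad R :=
      le_iSup₂ (f := fun (k : ℂ) (_ : k ∈ spectrum ℂ (toC R)) => (‖k‖₊ : ENNReal)) _ h
    have h3 := h2.trans_lt hR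
    rw [← ENNReal.coe_one, ENNReal.coe_lt_coe, ← NNReal.coe_lt_coe] at h3
    simp only [coe_nnnorm, Complex.norm_real, Real.norm_eq_abs, NNReal.coe_one] at h3
    have h4 : 1 ≤ u⁻¹ := (one_le_inv₀ hpos).2 hu.2
    exact absurd h3 (not_lt.2 (h4.trans (le_abs_self _)))
  have h2 : 1 - u • R = u • (u⁻¹ • (1 : Matrix (Fin n) (Fin n) ℝ) - R) := by
    rw [smul_sub, smul_smul, mul_inv_cancel₀ hpos.ne', one_smul]
  rw [h2, Matrix.det_smul]
  exact (isUnit_iff_ne_zero.2 (pow_ne_zero _ hpos.ne')).mul h1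

/-- A Hurwitz matrix whose negative is a Z-matrix maps some positive vector to `-1`. -/
theorem SwitchSys.IsHurwitz.exists_pos {Λ : Matrix (Fin n) (Fin n) ℝ} (hΛ : IsHurwitz Λ)
    (hZ : IsZMatrix (-Λ)) : ∃ η : Fin n → ℝ, (∀ i, 0 < η i) ∧ (-Λ) *ᵥ η = 1 := by
  set s₀ : ℝ := 1 + ∑ i, |(Λ *ᵥ 1) i| with hs₀
  have hs₀nn : 0 ≤ s₀ := by positivity
  have key := IsZMatrix.semipositive_of_path (ι := Fin n)
    (C := fun u => (s₀ - u) • (1 : Matrix (Fin n) (Fin n) ℝ) - Λ) (by fun_prop) hs₀nn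
    (η := 1) ?_ ?_ (fun _ => one_pos) ?_
  · simpa using key
  · intro u _ i j hij
    have := hZ i j hij
    simpa [hij] using this
  · exact fun u hu => hΛ.isUnit_det (sub_nonneg.2 hu.2)
  · intro i
    have h1 : |(Λ *ᵥ 1) i| ≤ ∑ i, |(Λ *ᵥ 1) i| :=
      Finset.single_le_sum (f := fun i => |(Λ *ᵥ 1) i|) (fun _ _ => abs_nonneg _)
        (Finset.mem_univ i)
    have h2 := le_abs_self ((Λ *ᵥ 1) i)
    rw [Matrix.sub_mulVec, Matrix.smul_mulVec, Matrix.one_mulVec]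
    simp only [sub_zero, Pi.sub_apply, Pi.smul_apply, Pi.one_apply, smul_eq_mul, mul_one]
    linarith

end Spectral

section Nonneg

variable {n : ℕ}

theorem mulVec_nonneg_of_nonneg {m n : Type*} [Fintype n] {M : Matrix m n ℝ}
    (hM : ∀ i j, 0 ≤ M i j) {x : n → ℝ} (hx : 0 ≤ x) : 0 ≤ M *ᵥ x := fun i =>
  Finset.sum_nonneg fun j _ => mul_nonneg (hM i j) (hx j)

theorem mulVec_mono_of_nonneg {m n : Type*} [Fintype n] {M : Matrix m n ℝ}
    (hM : ∀ i j, 0 ≤ M i j) {x y : n → ℝ} (hxy : x ≤ y) : M *ᵥ x ≤ M *ᵥ y := fun i =>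
  Finset.sum_le_sum fun j _ => mul_le_mul_of_nonneg_left (hxy j) (hM i j)

theorem SwitchSys.IsHurwitz.isUnit_det_self {Λ : Matrix (Fin n) (Fin n) ℝ} (hΛ : IsHurwitz Λ) :
    IsUnit Λ.det := by
  have h := hΛ.isUnit_det le_rfl
  rw [zero_smul, zero_sub, Matrix.det_neg, IsUnit.mul_iff] at h
  exact h.2

theorem SwitchSys.IsHurwitz.neg_inv_nonneg {Λ : Matrix (Fin n) (Fin n) ℝ} (hΛ : IsHurwitz Λ)
    (hZ : IsZMatrix (-Λ)) (i j : Fin n) : 0 ≤ (-Λ⁻¹) i j := by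
  obtain ⟨η, hη, h1⟩ := hΛ.exists_pos hZ
  have hu : IsUnit (-Λ).det := by
    have h := hΛ.isUnit_det le_rfl
    rwa [zero_smul, zero_sub] at h
  have h2 := hZ.inv_nonneg hu hη (by simp [h1]) i j
  have h3 : (-Λ)⁻¹ = -Λ⁻¹ := by
    refine Matrix.inv_eq_right_inv ?_
    rw [neg_mul_neg, Matrix.mul_nonsing_inv _ hΛ.isUnit_det_self]
  rwa [h3] at h2

theorem Rmat_nonneg {Λ F : Matrix (Fin n) (Fin n) ℝ} (hΛ : IsHurwitz Λ)
    (hZ : IsZMatrix (-Λ)) (hF : ∀ i j, 0 ≤ F i j) (i j : Fin n) : 0 ≤ Rmat Λ F i j := by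
  rw [Rmat, Matrix.mul_apply]
  exact Finset.sum_nonneg fun k _ => mul_nonneg (hΛ.neg_inv_nonneg hZ i k) (hF k j)

theorem isUnit_det_one_sub {R : Matrix (Fin n) (Fin n) ℝ} (hρ : specRad R < 1) :
    IsUnit (1 - R).det := by
  simpa using isUnit_det_one_sub_smul hρ (u := 1) ⟨zero_le_one, le_rfl⟩

theorem one_sub_inv_nonneg {R : Matrix (Fin n) (Fin n) ℝ} (hR : ∀ i j, 0 ≤ R i j)
    (hρ : specRad R < 1) (i j : Fin n) : 0 ≤ (1 - R)⁻¹ i j := by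
  have hZ : ∀ u : ℝ, 0 ≤ u → IsZMatrix (1 - u • R) := fun u hu i j hij => by
    have := mul_nonneg hu (hR i j)
    simpa [hij] using this
  obtain ⟨ζ, hζ, h1⟩ := IsZMatrix.semipositive_of_path (C := fun u => 1 - u • R) (by fun_prop)
    zero_le_one (fun u hu => hZ u hu.1) (fun u hu => isUnit_det_one_sub_smul hρ hu)
    (η := 1) (fun _ => one_pos) (by simp)
  have hZ1 : IsZMatrix (1 - R) := by simpa using hZ 1 zero_le_one
  refine hZ1.inv_nonneg (isUnit_det_one_sub hρ) hζ (fun i => ?_) i j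
  rw [one_smul] at h1
  simp [h1]

theorem mul_one_sub_Rmat {Λ : Matrix (Fin n) (Fin n) ℝ} (hΛ : IsUnit Λ.det)
    (F : Matrix (Fin n) (Fin n) ℝ) : Λ * (1 - Rmat Λ F) = Λ + F := by
  rw [Rmat, mul_sub, neg_mul, mul_neg, Matrix.mul_nonsing_inv_cancel_left _ _ hΛ, mul_one,
    sub_neg_eq_add]

/-- `(1 - R)⁻¹ (-Λ⁻¹)` is the inverse of `-(Λ + F)`. -/
theorem neg_add_mul_inv {Λ F : Matrix (Fin n) (Fin n) ℝ} (hΛ : IsUnit Λ.det)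
    (hR : IsUnit (1 - Rmat Λ F).det) :
    -(Λ + F) * ((1 - Rmat Λ F)⁻¹ * (-Λ⁻¹)) = 1 := by
  rw [← mul_one_sub_Rmat hΛ F, mul_neg, neg_mul_neg, mul_assoc,
    Matrix.mul_nonsing_inv_cancel_left _ _ hR, Matrix.mul_nonsing_inv _ hΛ]

/-- A matrix with nonnegative inverse which is also a Z-matrix is semipositive. -/
theorem IsZMatrix.exists_pos_of_right_inv {C Q : Matrix (Fin n) (Fin n) ℝ} (hC : IsZMatrix C)
    (hQ : ∀ i j, 0 ≤ Q i j) (hCQ : C * Q = 1) :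
    ∃ η : Fin n → ℝ, (∀ i, 0 < η i) ∧ C *ᵥ η = 1 := by
  have h1 : C *ᵥ (Q *ᵥ 1) = 1 := by rw [Matrix.mulVec_mulVec, hCQ, Matrix.one_mulVec]
  exact ⟨Q *ᵥ 1, hC.pos_of_nonneg (mulVec_nonneg_of_nonneg hQ zero_le_one) (by simp [h1]), h1⟩

end Nonneg

section Combined

variable {n : ℕ} {Λ F : Matrix (Fin n) (Fin n) ℝ}

theorem IsZMatrix.neg_add (hZ : IsZMatrix (-Λ)) (hF : ∀ i j, 0 ≤ F i j) :
    IsZMatrix (-(Λ + F)) := fun i j hij => by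
  have h1 := hZ i j hij
  have h2 := hF i j
  simp only [Matrix.neg_apply, Matrix.add_apply] at h1 ⊢
  linarith

theorem inv_mul_neg_inv_nonneg (hΛ : IsHurwitz Λ) (hZ : IsZMatrix (-Λ))
    (hF : ∀ i j, 0 ≤ F i j) (hρ : specRad (Rmat Λ F) < 1) (i j : Fin n) :
    0 ≤ ((1 - Rmat Λ F)⁻¹ * (-Λ⁻¹)) i j := by
  rw [Matrix.mul_apply]
  exact Finset.sum_nonneg fun k _ => mul_nonneg
    (one_sub_inv_nonneg (Rmat_nonneg hΛ hZ hF) hρ i k) (hΛ.neg_inv_nonneg hZ k j)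

theorem bTilde_nonneg (hΛ : IsHurwitz Λ) (hZ : IsZMatrix (-Λ))
    (hF : ∀ i j, 0 ≤ F i j) (hρ : specRad (Rmat Λ F) < 1) {wbar : Fin n → ℝ} (hw : 0 ≤ wbar) :
    0 ≤ bTilde Λ F wbar := by
  rw [bTilde, Matrix.mulVec_mulVec]
  exact mulVec_nonneg_of_nonneg (inv_mul_neg_inv_nonneg hΛ hZ hF hρ) hw

theorem add_mulVec_bTilde (hΛ : IsHurwitz Λ) (hρ : specRad (Rmat Λ F) < 1) (wbar : Fin n → ℝ) :
    Λ *ᵥ bTilde Λ F wbar + (F *ᵥ bTilde Λ F wbar + wbar) = 0 := by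
  have h : -(Λ + F) *ᵥ bTilde Λ F wbar = wbar := by
    rw [bTilde, Matrix.mulVec_mulVec, Matrix.mulVec_mulVec, mul_assoc,
      neg_add_mul_inv hΛ.isUnit_det_self (isUnit_det_one_sub hρ), Matrix.one_mulVec]
  rw [Matrix.neg_mulVec, Matrix.add_mulVec] at h
  nth_rw 3 [← h]
  abel

/-- A symmetric matrix with nonpositive off-diagonal entries that maps a positive vector to a
positive vector is positive definite. -/
theorem IsZMatrix.posDef_of_semipositive {S : Matrix (Fin n) (Fin n) ℝ} (hS : IsZMatrix S)
    (hsymm : S.IsSymm) {η : Fin n → ℝ} (hη : ∀ i, 0 < η i) (hSη : ∀ i, 0 < (S *ᵥ η) i) :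
    S.PosDef := by
  refine Matrix.PosDef.of_dotProduct_mulVec_pos (by simpa [Matrix.IsHermitian] using hsymm.eq) ?_
  intro x hx
  rw [star_trivial]
  have hterm : ∀ i j, S i j * η i * η j * (((x i / η i) ^ 2 + (x j / η j) ^ 2) / 2)
      ≤ x i * (S i j * x j) := by
    intro i j
    have hi := (hη i).ne'
    have hj := (hη j).ne'
    have h1 : x i * (S i j * x j) = S i j * η i * η j * ((x i / η i) * (x j / η j)) := by
      field_simp
    rw [h1]
    by_cases hij : i = j
    · subst hij; apply le_of_eq; ring
    · refine mul_le_mul_of_nonpos_left ?_ ?_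
      · nlinarith [sq_nonneg (x i / η i - x j / η j)]
      · exact mul_nonpos_of_nonpos_of_nonneg
          (mul_nonpos_of_nonpos_of_nonneg (hS i j hij) (hη i).le) (hη j).le
  have hsum : ∑ i, ∑ j, S i j * η i * η j * (((x i / η i) ^ 2 + (x j / η j) ^ 2) / 2)
      = ∑ i, η i * (x i / η i) ^ 2 * (S *ᵥ η) i := by
    have h1 : ∀ i, η i * (x i / η i) ^ 2 * (S *ᵥ η) i
        = ∑ j, S i j * η i * η j * (x i / η i) ^ 2 := fun i => by
      rw [Matrix.mulVec, dotProduct, Finset.mul_sum]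
      exact Finset.sum_congr rfl fun j _ => by ring
    have h2 : ∑ i, ∑ j, S i j * η i * η j * (x j / η j) ^ 2
        = ∑ i, ∑ j, S i j * η i * η j * (x i / η i) ^ 2 := by
      rw [Finset.sum_comm]
      refine Finset.sum_congr rfl fun i _ => Finset.sum_congr rfl fun j _ => ?_
      rw [← hsymm.apply i j]; ring
    simp_rw [h1]
    calc _ = (∑ i, ∑ j, S i j * η i * η j * (x i / η i) ^ 2
        + ∑ i, ∑ j, S i j * η i * η j * (x j / η j) ^ 2) / 2 := by
          simp_rw [← Finset.sum_add_distrib, Finset.sum_div]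
          exact Finset.sum_congr rfl fun i _ => Finset.sum_congr rfl fun j _ => by ring
      _ = _ := by rw [h2]; ring
  have hpos : 0 < ∑ i, η i * (x i / η i) ^ 2 * (S *ᵥ η) i := by
    obtain ⟨i, hi⟩ := Function.ne_iff.1 hx
    refine Finset.sum_pos' (fun j _ => ?_) ⟨i, Finset.mem_univ _, ?_⟩
    · exact mul_nonneg (mul_nonneg (hη j).le (sq_nonneg _)) (hSη j).le
    · have : x i / η i ≠ 0 := div_ne_zero hi (hη i).ne'
      exact mul_pos (mul_pos (hη i) (by positivity)) (hSη i)
  calc (0 : ℝ) < _ := hpos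
    _ = _ := hsum.symm
    _ ≤ ∑ i, ∑ j, x i * (S i j * x j) :=
      Finset.sum_le_sum fun i _ => Finset.sum_le_sum fun j _ => hterm i j
    _ = _ := by simp [dotProduct, Matrix.mulVec, Finset.mul_sum]

/-- Diagonal stability of a matrix whose negative is a nonsingular M-matrix. -/
theorem exists_isDiagLyap {M Q : Matrix (Fin n) (Fin n) ℝ} (hM : IsZMatrix (-M))
    (hQ : ∀ i j, 0 ≤ Q i j) (hMQ : -M * Q = 1) : ∃ D, IsDiagLyap M D := by
  obtain ⟨η, hη, h1⟩ := hM.exists_pos_of_right_inv hQ hMQ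
  obtain ⟨ξ, hξ, h2⟩ := IsZMatrix.exists_pos_of_right_inv (C := (-M)ᵀ) (Q := Qᵀ)
    (fun i j hij => hM j i hij.symm) (fun i j => hQ j i) (by
      rw [← Matrix.transpose_mul, mul_eq_one_comm.1 hMQ, Matrix.transpose_one])
  have hd : ∀ i, 0 < ξ i / η i := fun i => div_pos (hξ i) (hη i)
  refine ⟨Matrix.diagonal fun i => ξ i / η i, Matrix.isDiag_diagonal _,
    Matrix.PosDef.diagonal hd, ?_⟩
  have hDη : (Matrix.diagonal fun i => ξ i / η i) *ᵥ η = ξ := by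
    ext i
    rw [Matrix.mulVec_diagonal]
    exact div_mul_cancel₀ _ (hη i).ne'
  refine IsZMatrix.posDef_of_semipositive (η := η) ?_ ?_ hη ?_
  · intro i j hij
    have h3 := mul_nonneg (hd j).le (neg_nonneg.2 (hM j i hij.symm))
    have h4 := mul_nonneg (hd i).le (neg_nonneg.2 (hM i j hij))
    simp only [Matrix.neg_apply, Matrix.add_apply, Matrix.mul_diagonal, Matrix.diagonal_mul,
      Matrix.transpose_apply] at h3 h4 ⊢
    linarith
  · rw [Matrix.IsSymm, Matrix.transpose_neg, Matrix.transpose_add, Matrix.transpose_mul,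
      Matrix.transpose_mul, Matrix.diagonal_transpose, Matrix.transpose_transpose, add_comm]
  · intro i
    have h5 : -(Mᵀ * (Matrix.diagonal fun i => ξ i / η i)
        + (Matrix.diagonal fun i => ξ i / η i) * M) *ᵥ η
        = (-M)ᵀ *ᵥ ξ + (Matrix.diagonal fun i => ξ i / η i) *ᵥ ((-M) *ᵥ η) := by
      rw [Matrix.neg_mulVec, Matrix.add_mulVec, ← Matrix.mulVec_mulVec, hDη,
        ← Matrix.mulVec_mulVec, Matrix.neg_mulVec, Matrix.mulVec_neg, Matrix.transpose_neg,
        Matrix.neg_mulVec, neg_add]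
    rw [h5, h1, h2, Pi.add_apply, Matrix.mulVec_diagonal]
    simp only [Pi.one_apply, mul_one]
    linarith [hd i]

end Combined

/-! ### Squares of indefinite integrals -/

section Squares

theorem sq_sub_sq_eq_integral {f x : ℝ → ℝ} {s t : ℝ} (hst : s ≤ t)
    (hf : IntervalIntegrable f volume s t)
    (hx : ∀ u ∈ Set.Icc s t, x u = x s + ∫ v in s..u, f v) :
    IntervalIntegrable (fun u => 2 * (x u * f u)) volume s t ∧
      x t ^ 2 - x s ^ 2 = ∫ u in s..t, 2 * (x u * f u) := by
  set X : ℝ → ℝ := fun u => x s + ∫ v in s..u, f v with hX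
  have hI := hf.absolutelyContinuousOnInterval_intervalIntegral (c := s) Set.left_mem_uIcc
  have hc : AbsolutelyContinuousOnInterval (fun _ : ℝ => x s) s t :=
    (LipschitzWith.const (x s)).lipschitzOnWith.absolutelyContinuousOnInterval
  have hAC : AbsolutelyContinuousOnInterval X s t := hc.add hI
  have hmem : ∀ u ∈ Set.uIcc s t, x u = X u := fun u hu => hx u (by rwa [Set.uIcc_of_le hst] at hu)
  have hintegr : IntervalIntegrable (fun u => 2 * (X u * f u)) volume s t :=
    (hf.continuousOn_mul hAC.continuousOn).const_mul 2
  refine ⟨hintegr.congr fun u hu => ?_, ?_⟩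
  · rw [hmem u (Set.uIoc_subset_uIcc hu)]
  · have h1 := hAC.integral_deriv_mul_eq_sub hAC
    rw [hmem t Set.right_mem_uIcc, hmem s Set.left_mem_uIcc, sq, sq, ← h1]
    refine intervalIntegral.integral_congr_ae ?_
    filter_upwards [hf.ae_hasDerivAt_integral] with u hu hu'
    have hu'' := Set.uIoc_subset_uIcc hu'
    have h2 : HasDerivAt X (f u) u := (hu hu'' s Set.left_mem_uIcc).const_add (x s)
    rw [h2.deriv, hmem u hu'']; ring

theorem norm_sq_sub_norm_sq_eq_integral {f z : ℝ → ℂ} {s t : ℝ} (hst : s ≤ t)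
    (hf : IntervalIntegrable f volume s t)
    (hz : ∀ u ∈ Set.Icc s t, z u = z s + ∫ v in s..u, f v) :
    IntervalIntegrable (fun u => 2 * (star (z u) * f u).re) volume s t ∧
      ‖z t‖ ^ 2 - ‖z s‖ ^ 2 = ∫ u in s..t, 2 * (star (z u) * f u).re := by
  have hsub : ∀ u ∈ Set.Icc s t, IntervalIntegrable f volume s u := fun u hu =>
    hf.mono_set (by rw [Set.uIcc_of_le hst, Set.uIcc_of_le hu.1]; exact Set.Icc_subset_Icc_right hu.2)
  have hre : IntervalIntegrable (fun u => (f u).re) volume s t := ⟨hf.1.re, hf.2.re⟩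
  have him : IntervalIntegrable (fun u => (f u).im) volume s t := ⟨hf.1.im, hf.2.im⟩
  obtain ⟨i1, e1⟩ := sq_sub_sq_eq_integral (x := fun u => (z u).re) hst hre fun u hu => by
    have h := Complex.reCLM.intervalIntegral_comp_comm (hsub u hu)
    simp only [Complex.reCLM_apply] at h
    change (z u).re = (z s).re + _
    rw [h, hz u hu, Complex.add_re]
  obtain ⟨i2, e2⟩ := sq_sub_sq_eq_integral (x := fun u => (z u).im) hst him fun u hu => by
    have h := Complex.imCLM.intervalIntegral_comp_comm (hsub u hu)
    simp only [Complex.imCLM_apply] at h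
    change (z u).im = (z s).im + _
    rw [h, hz u hu, Complex.add_im]
  have hfun : (fun u => 2 * (star (z u) * f u).re)
      = fun u => 2 * ((z u).re * (f u).re) + 2 * ((z u).im * (f u).im) := by
    ext u; simp [Complex.mul_re]; ring
  rw [hfun]
  refine ⟨i1.add i2, ?_⟩
  rw [intervalIntegral.integral_add i1 i2, ← e1, ← e2, Complex.sq_norm, Complex.sq_norm,
    Complex.normSq_apply, Complex.normSq_apply]
  ring

end Squares

/-! ### A comparison principle for delay differential inequalities -/

section Comparison

variable {n : ℕ}

/-- For `t ≥ T`, the nonnegative function `u` satisfies the delay differential inequality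
`u' ≤ Λ u + F (max over [t - τ, t] of u) + w`, stated for the squares of its components: `g j` is
the derivative of `u j ^ 2`. -/
structure DelayIneq (Λ F : Matrix (Fin n) (Fin n) ℝ) (w : Fin n → ℝ) (τ T : ℝ)
    (u g : ℝ → Fin n → ℝ) : Prop where
  nonneg : ∀ t, 0 ≤ u t
  cont : ContinuousOn u (Set.Ici (T - τ))
  integrable : ∀ j s t, T ≤ s → s ≤ t → IntervalIntegrable (fun v => g v j) volume s t
  sq_sub_sq : ∀ j s t, T ≤ s → s ≤ t → u t j ^ 2 - u s j ^ 2 = ∫ v in s..t, g v j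
  le : ∀ t, T ≤ t → ∀ c, (∀ s ∈ Set.Icc (t - τ) t, u s ≤ c) →
    ∀ j, g t j ≤ 2 * (u t j * ((Λ *ᵥ u t) j + (F *ᵥ c + w) j))

variable {Λ F : Matrix (Fin n) (Fin n) ℝ} {w b η : Fin n → ℝ} {τ T : ℝ} {u g : ℝ → Fin n → ℝ}

theorem IsZMatrix.mulVec_le_of_apply_eq (hZ : IsZMatrix (-Λ)) {x y : Fin n → ℝ}
    (hxy : x ≤ y) {j : Fin n} (hj : x j = y j) : (Λ *ᵥ x) j ≤ (Λ *ᵥ y) j := by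
  have h := hZ.mulVec_nonpos_of_apply_eq_zero (y := y - x) (sub_nonneg.2 hxy) (i := j)
    (by simp [hj])
  rw [Matrix.neg_mulVec, Matrix.mulVec_sub] at h
  simp only [Pi.neg_apply, Pi.sub_apply] at h
  linarith

/-- A bound `b + exp (-r (t - T)) η` on a history interval is preserved to the right. -/
theorem DelayIneq.eventually_le (h : DelayIneq Λ F w τ T u g) (hτ : 0 ≤ τ)
    (hZ : IsZMatrix (-Λ)) (hb : 0 ≤ b)
    (hbeq : Λ *ᵥ b + (F *ᵥ b + w) ≤ 0) (hη : ∀ i, 0 < η i) {r μ : ℝ} (hr : 0 < r)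
    (hμ : Real.exp (r * τ) < μ)
    (hηlt : ∀ j, (Λ *ᵥ η) j + μ * (F *ᵥ η) j + r * η j < 0) {t₁ : ℝ} (ht₁ : T ≤ t₁)
    (hle : ∀ s ∈ Set.Icc (T - τ) t₁, u s ≤ b + Real.exp (-(r * (s - T))) • η) (j : Fin n) :
    ∀ᶠ t in 𝓝[>] t₁, u t j ≤ b j + Real.exp (-(r * (t - T))) * η j := by
  set E : ℝ → ℝ := fun s => Real.exp (-(r * (s - T))) with hE
  have hEpos : ∀ s, 0 < E s := fun s => Real.exp_pos _
  have hEcont : Continuous E := by fun_prop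
  have hEderiv : ∀ s, HasDerivAt E (-(r * E s)) s := fun s => by
    have h1 : HasDerivAt (fun s => -(r * (s - T))) (-(r * 1)) s :=
      (((hasDerivAt_id s).sub_const T).const_mul r).neg
    have h2 := h1.exp
    convert! h2 using 1
    simp only [hE]; ring
  have hcontIci : ∀ i, ContinuousWithinAt (fun t => u t i) (Set.Ici t₁) t₁ := fun i => by
    have h1 : ContinuousWithinAt u (Set.Ici t₁) t₁ :=
      (h.cont t₁ (by simp only [Set.mem_Ici]; linarith)).mono
        (Set.Ici_subset_Ici.2 (by linarith))
    exact (continuous_apply i).continuousAt.comp_continuousWithinAt h1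
  have hcontΛ : ContinuousWithinAt (fun t => (Λ *ᵥ u t) j) (Set.Ici t₁) t₁ := by
    simp only [Matrix.mulVec, dotProduct]
    exact tendsto_finsetSum _ fun i _ => (hcontIci i).const_mul (Λ j i)
  have hut₁ : u t₁ ≤ b + E t₁ • η := hle t₁ ⟨by linarith, le_rfl⟩
  rcases lt_or_eq_of_le (hut₁ j) with hlt | heq
  · have h1 : ContinuousWithinAt (fun t => b j + E t * η j) (Set.Ici t₁) t₁ := by
      have : Continuous fun t => b j + E t * η j := by fun_prop
      exact this.continuousWithinAt
    have h2 := (hcontIci j).eventually_lt h1 (by simpa using hlt)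
    filter_upwards [nhdsWithin_mono _ Set.Ioi_subset_Ici_self h2] with t ht using ht.le
  · set c : Fin n → ℝ := b + (μ * E t₁) • η with hc
    have hexp1 : 1 ≤ Real.exp (r * τ) := Real.one_le_exp (by positivity)
    have hμ1 : 1 < μ := lt_of_le_of_lt hexp1 hμ
    set cj : ℝ → ℝ := fun t => b j + E t * η j with hcj
    have hcjcont : Continuous cj := by fun_prop
    have hcjpos : ∀ t, 0 < cj t := fun t =>
      add_pos_of_nonneg_of_pos (hb j) (mul_pos (hEpos t) (hη j))
    have heq' : u t₁ j = cj t₁ := by simpa using heq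
    have hneg : u t₁ j * ((Λ *ᵥ u t₁) j + (F *ᵥ c + w) j) < -(r * (cj t₁ * (E t₁ * η j))) := by
      have h1 := hZ.mulVec_le_of_apply_eq hut₁ heq
      have h2 : (Λ *ᵥ (b + E t₁ • η)) j + (F *ᵥ c + w) j
          = (Λ *ᵥ b + (F *ᵥ b + w)) j + E t₁ * ((Λ *ᵥ η) j + μ * (F *ᵥ η) j) := by
        rw [hc, Matrix.mulVec_add, Matrix.mulVec_add, Matrix.mulVec_smul, Matrix.mulVec_smul]
        simp only [Pi.add_apply, Pi.smul_apply, smul_eq_mul]; ring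
      have h3 := hbeq j
      have h4 := mul_neg_of_pos_of_neg (hEpos t₁) (hηlt j)
      have h5 : (Λ *ᵥ u t₁) j + (F *ᵥ c + w) j < -(r * (E t₁ * η j)) := by
        simp only [Pi.zero_apply] at h3
        linarith
      rw [heq']
      have := mul_lt_mul_of_pos_left h5 (hcjpos t₁)
      linarith
    have hev1 : ∀ᶠ t in 𝓝[≥] t₁, u t j * ((Λ *ᵥ u t) j + (F *ᵥ c + w) j)
        < -(r * (cj t * (E t * η j))) := by
      refine Filter.Tendsto.eventually_lt ((hcontIci j).mul (hcontΛ.add_const _)) ?_ hneg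
      have : Continuous fun t => -(r * (cj t * (E t * η j))) := by fun_prop
      exact this.continuousWithinAt
    have hev2 : ∀ᶠ t in 𝓝[≥] t₁, ∀ i, u t i < c i := by
      refine eventually_all.2 fun i => (hcontIci i).eventually_lt continuousWithinAt_const ?_
      refine (hut₁ i).trans_lt ?_
      have := mul_lt_mul_of_pos_right hμ1 (mul_pos (hEpos t₁) (hη i))
      simp only [hc, Pi.add_apply, Pi.smul_apply, smul_eq_mul]
      linarith
    obtain ⟨t₂, ht₂, hIco⟩ := (mem_nhdsGE_iff_exists_Ico_subset).1 (hev1.and hev2)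
    have hmem : Set.Ioo t₁ t₂ ∈ 𝓝[>] t₁ := Ioo_mem_nhdsGT ht₂
    filter_upwards [hmem] with t ht
    have hg : ∀ v ∈ Set.Icc t₁ t, g v j ≤ -(2 * (r * (cj v * (E v * η j)))) := by
      intro v hv
      have hvI : v ∈ Set.Ico t₁ t₂ := ⟨hv.1, hv.2.trans_lt ht.2⟩
      have h1 := (hIco hvI).1
      have h2 := h.le v (ht₁.trans hv.1) c ?_ j
      · linarith
      intro s hs i
      rcases le_total s t₁ with hst | hst
      · refine (hle s ⟨by linarith [hs.1, hv.1], hst⟩ i).trans ?_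
        have h3 : E s ≤ Real.exp (r * τ) * E t₁ := by
          simp only [hE]
          rw [← Real.exp_add]
          refine Real.exp_le_exp.2 ?_
          have : r * (t₁ - s) ≤ r * τ :=
            mul_le_mul_of_nonneg_left (by linarith [hs.1, hv.1]) hr.le
          linarith
        have h4 : E s ≤ μ * E t₁ := h3.trans (mul_le_mul_of_nonneg_right hμ.le (hEpos _).le)
        have := mul_le_mul_of_nonneg_right h4 (hη i).le
        simp only [hc, Pi.add_apply, Pi.smul_apply, smul_eq_mul]
        linarith
      · exact ((hIco ⟨hst, hs.2.trans_lt hvI.2⟩).2 i).le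
    have hd : ∀ v, HasDerivAt (fun v => cj v ^ 2) (-(2 * (r * (cj v * (E v * η j))))) v := by
      intro v
      have h1 := (((hEderiv v).mul_const (η j)).const_add (b j)).pow 2
      convert! h1 using 1
      simp only [hcj]; push_cast; ring
    have hcont' : Continuous fun v => -(2 * (r * (cj v * (E v * η j)))) := by fun_prop
    have hFTC := intervalIntegral.integral_eq_sub_of_hasDerivAt (a := t₁) (b := t)
      (fun v _ => hd v) (hcont'.intervalIntegrable _ _)
    have hmono := intervalIntegral.integral_mono_on ht.1.le (h.integrable j t₁ t ht₁ ht.1.le)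
      (hcont'.intervalIntegrable _ _) hg
    rw [← h.sq_sub_sq j t₁ t ht₁ ht.1.le, hFTC, heq'] at hmono
    have hsq : u t j ^ 2 ≤ cj t ^ 2 := by linarith
    exact (pow_le_pow_iff_left₀ (h.nonneg t j) (hcjpos t).le two_ne_zero).1 hsq

theorem DelayIneq.le_add_exp (h : DelayIneq Λ F w τ T u g) (hτ : 0 ≤ τ)
    (hZ : IsZMatrix (-Λ)) (hb : 0 ≤ b)
    (hbeq : Λ *ᵥ b + (F *ᵥ b + w) ≤ 0) (hη : ∀ i, 0 < η i) {r μ : ℝ} (hr : 0 < r)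
    (hμ : Real.exp (r * τ) < μ)
    (hηlt : ∀ j, (Λ *ᵥ η) j + μ * (F *ᵥ η) j + r * η j < 0)
    (hle : ∀ s ∈ Set.Icc (T - τ) T, u s ≤ b + Real.exp (-(r * (s - T))) • η)
    {t : ℝ} (ht : T ≤ t) : u t ≤ b + Real.exp (-(r * (t - T))) • η := by
  have hsub : Set.Icc T t ⊆ {s | u s ≤ b + Real.exp (-(r * (s - T))) • η} := by
    refine IsClosed.Icc_subset_of_forall_mem_nhdsGT_of_Icc_subset ?_ ?_ ?_
    · rw [Set.inter_comm]
      have hc1 : ContinuousOn u (Set.Icc T t) :=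
        h.cont.mono fun s hs => by simp only [Set.mem_Ici]; linarith [hs.1]
      have hc2 : Continuous fun s => b + Real.exp (-(r * (s - T))) • η := by fun_prop
      have := ContinuousOn.preimage_isClosed_of_isClosed (hc2.continuousOn.sub hc1) isClosed_Icc
        (isClosed_Ici (a := (0 : Fin n → ℝ)))
      convert this using 2
      ext s; simp
    · exact hle T ⟨by linarith, le_rfl⟩
    · intro t₁ ht₁ hI
      have hle' : ∀ s ∈ Set.Icc (T - τ) t₁, u s ≤ b + Real.exp (-(r * (s - T))) • η := by
        intro s hs
        rcases le_total s T with h1 | h1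
        · exact hle s ⟨hs.1, h1⟩
        · exact hI ⟨h1, hs.2⟩
      filter_upwards [eventually_all.2 fun j =>
        h.eventually_le hτ hZ hb hbeq hη hr hμ hηlt ht₁.1 hle' j] with s hs j
      simpa using hs j
  exact hsub ⟨ht, le_rfl⟩

theorem exists_decay_rate (τ : ℝ) (hηlt : ∀ j, (Λ *ᵥ η) j + (F *ᵥ η) j < 0) :
    ∃ r μ : ℝ, 0 < r ∧ Real.exp (r * τ) < μ ∧
      ∀ j, (Λ *ᵥ η) j + μ * (F *ᵥ η) j + r * η j < 0 := by
  have hev : ∀ j, ∀ᶠ r : ℝ in 𝓝 0,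
      (Λ *ᵥ η) j + (Real.exp (r * τ) + r) * (F *ᵥ η) j + r * η j < 0 := fun j => by
    have hc : Continuous fun r : ℝ =>
        (Λ *ᵥ η) j + (Real.exp (r * τ) + r) * (F *ᵥ η) j + r * η j := by fun_prop
    refine hc.continuousAt.eventually (gt_mem_nhds ?_)
    simpa using hηlt j
  have h2 : ∀ᶠ r : ℝ in 𝓝[>] 0, 0 < r := self_mem_nhdsWithin
  obtain ⟨r, hr1, hr2⟩ :=
    (((eventually_all.2 hev).filter_mono nhdsWithin_le_nhds).and h2).exists
  exact ⟨r, Real.exp (r * τ) + r, hr2, by linarith, hr1⟩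

/-- Invariance of the box `u ≤ b`. -/
theorem DelayIneq.le_of_le (h : DelayIneq Λ F w τ T u g) (hτ : 0 ≤ τ)
    (hZ : IsZMatrix (-Λ)) (hb : 0 ≤ b)
    (hbeq : Λ *ᵥ b + (F *ᵥ b + w) ≤ 0) (hη : ∀ i, 0 < η i)
    (hηlt : ∀ j, (Λ *ᵥ η) j + (F *ᵥ η) j < 0)
    (hle : ∀ s ∈ Set.Icc (T - τ) T, u s ≤ b) {t : ℝ} (ht : T ≤ t) : u t ≤ b := by
  obtain ⟨r, μ, hr, hμ, hlt⟩ := exists_decay_rate τ hηlt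
  intro j
  refine le_of_forall_pos_le_add fun ε hε => ?_
  set κ : ℝ := ε / η j with hκ
  have hκpos : 0 < κ := div_pos hε (hη j)
  have h1 := h.le_add_exp (η := κ • η) hτ hZ hb hbeq (fun i => mul_pos hκpos (hη i)) hr hμ
    (fun i => by
      rw [Matrix.mulVec_smul, Matrix.mulVec_smul]
      simp only [Pi.smul_apply, smul_eq_mul]
      have := mul_neg_of_pos_of_neg hκpos (hlt i)
      linarith)
    (fun s hs i => (hle s hs i).trans (by
      have := mul_pos (Real.exp_pos (-(r * (s - T)))) (mul_pos hκpos (hη i))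
      simp only [Pi.add_apply, Pi.smul_apply, smul_eq_mul]
      linarith)) ht j
  refine h1.trans ?_
  have h2 : Real.exp (-(r * (t - T))) ≤ 1 :=
    Real.exp_le_one_iff.2 (neg_nonpos.2 (mul_nonneg hr.le (sub_nonneg.2 ht)))
  have h3 : κ * η j = ε := div_mul_cancel₀ _ (hη j).ne'
  simp only [Pi.add_apply, Pi.smul_apply, smul_eq_mul, h3]
  have := mul_le_mul_of_nonneg_right h2 hε.le
  linarith

/-- The box `u ≤ b` attracts all solutions. -/
theorem DelayIneq.eventually_le_add (h : DelayIneq Λ F w τ T u g) (hτ : 0 ≤ τ)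
    (hZ : IsZMatrix (-Λ)) (hb : 0 ≤ b)
    (hbeq : Λ *ᵥ b + (F *ᵥ b + w) ≤ 0) (hη : ∀ i, 0 < η i)
    (hηlt : ∀ j, (Λ *ᵥ η) j + (F *ᵥ η) j < 0) (j : Fin n) {ε : ℝ} (hε : 0 < ε) :
    ∀ᶠ t in atTop, u t j ≤ b j + ε := by
  obtain ⟨r, μ, hr, hμ, hlt⟩ := exists_decay_rate τ hηlt
  obtain ⟨K, hK, hKle⟩ : ∃ K : ℝ, 0 < K ∧ ∀ s ∈ Set.Icc (T - τ) T, u s ≤ K • η := by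
    have hbd : ∀ i, ∃ K : ℝ, ∀ s ∈ Set.Icc (T - τ) T, u s i ≤ K := fun i => by
      have hci : ContinuousOn (fun s => u s i) (Set.Icc (T - τ) T) :=
        (continuous_apply i).comp_continuousOn (h.cont.mono Set.Icc_subset_Ici_self)
      obtain ⟨K, hK⟩ := (isCompact_Icc.image_of_continuousOn hci).bddAbove
      exact ⟨K, fun s hs => hK ⟨s, hs, rfl⟩⟩
    choose K hK using hbd
    refine ⟨1 + ∑ i, |K i| / η i, ?_, fun s hs i => (hK i s hs).trans ?_⟩
    · have : 0 ≤ ∑ i, |K i| / η i :=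
        Finset.sum_nonneg fun i _ => div_nonneg (abs_nonneg _) (hη i).le
      linarith
    · have h1 : |K i| / η i ≤ ∑ i, |K i| / η i :=
        Finset.single_le_sum (f := fun i => |K i| / η i)
          (fun i _ => div_nonneg (abs_nonneg _) (hη i).le) (Finset.mem_univ i)
      have h2 : |K i| / η i ≤ 1 + ∑ i, |K i| / η i := by linarith
      rw [div_le_iff₀ (hη i)] at h2
      exact (le_abs_self _).trans h2
  have h1 : ∀ t, T ≤ t → u t ≤ b + Real.exp (-(r * (t - T))) • (K • η) := fun t ht =>
    h.le_add_exp (η := K • η) hτ hZ hb hbeq (fun i => mul_pos hK (hη i)) hr hμ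
      (fun i => by
        rw [Matrix.mulVec_smul, Matrix.mulVec_smul]
        simp only [Pi.smul_apply, smul_eq_mul]
        have := mul_neg_of_pos_of_neg hK (hlt i)
        linarith)
      (fun s hs i => (hKle s hs i).trans (by
        have h2 : 1 ≤ Real.exp (-(r * (s - T))) := Real.one_le_exp
          (neg_nonneg.2 (mul_nonpos_of_nonneg_of_nonpos hr.le (sub_nonpos.2 hs.2)))
        have h3 := mul_le_mul_of_nonneg_right h2 (mul_pos hK (hη i)).le
        have h4 := hb i
        simp only [Pi.add_apply, Pi.smul_apply, smul_eq_mul, Pi.zero_apply] at h4 ⊢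
        linarith)) ht
  have hlim : Tendsto (fun t => Real.exp (-(r * (t - T))) * (K * η j)) atTop (𝓝 0) := by
    have h2 : Tendsto (fun t => r * (t - T)) atTop atTop :=
      (tendsto_atTop_add_const_right _ (-T) tendsto_id).const_mul_atTop hr
    simpa using (Real.tendsto_exp_neg_atTop_nhds_zero.comp h2).mul_const (K * η j)
  filter_upwards [hlim.eventually (gt_mem_nhds hε), eventually_ge_atTop T] with t ht1 ht2
  have := h1 t ht2 j
  simp only [Pi.add_apply, Pi.smul_apply, smul_eq_mul] at this
  linarith

end Comparison

/-! ### Estimates for a single mode -/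

section Algebra

variable {n N : ℕ} {k : Fin N → ℕ}

/-- The real-linear functional `x ↦ (M x) j`, for a complex matrix `M` and a real vector `x`. -/
noncomputable def rowFunctional {m n : ℕ} (M : Matrix (Fin m) (Fin n) ℂ) (j : Fin m) :
    (Fin n → ℝ) →L[ℝ] ℂ :=
  LinearMap.toContinuousLinearMap
    { toFun := fun x => (M *ᵥ fun l => (x l : ℂ)) j
      map_add' := fun x y => by
        rw [← Pi.add_apply (M *ᵥ _), ← Matrix.mulVec_add]
        congr 2
        ext l; simp
      map_smul' := fun c x => by
        have : (fun l => (((c • x) l : ℝ) : ℂ)) = (c : ℂ) • fun l => (x l : ℂ) := by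
          ext l; simp
        rw [this, Matrix.mulVec_smul]
        simp }

theorem rowFunctional_apply {m n : ℕ} (M : Matrix (Fin m) (Fin n) ℂ) (j : Fin m)
    (x : Fin n → ℝ) : rowFunctional M j x = (M *ᵥ fun l => (x l : ℂ)) j := rfl

theorem absMulVec_eq_norm {m n : ℕ} (M : Matrix (Fin m) (Fin n) ℂ) (x : Fin n → ℝ) (j : Fin m) :
    absMulVec M x j = ‖rowFunctional M j x‖ := rfl

theorem absMulVec_nonneg {m n : ℕ} (M : Matrix (Fin m) (Fin n) ℂ) (x : Fin n → ℝ) :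
    0 ≤ absMulVec M x := fun _ => norm_nonneg _

theorem toC_mulVec {m n : ℕ} (M : Matrix (Fin m) (Fin n) ℝ) (x : Fin n → ℝ) :
    toC M *ᵥ (fun l => (x l : ℂ)) = fun l => ((M *ᵥ x) l : ℂ) := by
  ext i
  exact (RingHom.map_mulVec Complex.ofRealHom M x i).symm

theorem abs_le_absMat_mulVec {V : Matrix (Fin n) (Fin n) ℂ} (hV : IsUnit V) (x : Fin n → ℝ)
    (l : Fin n) : |x l| ≤ (absMat V *ᵥ absMulVec V⁻¹ x) l := by
  have h1 : (x l : ℂ) = (V *ᵥ (V⁻¹ *ᵥ fun l => (x l : ℂ))) l := by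
    rw [Matrix.mulVec_mulVec, Matrix.mul_nonsing_inv _ ((Matrix.isUnit_iff_isUnit_det _).1 hV),
      Matrix.one_mulVec]
  calc |x l| = ‖(x l : ℂ)‖ := by simp
    _ = ‖∑ m, V l m * (V⁻¹ *ᵥ fun l => (x l : ℂ)) m‖ := by rw [h1]; rfl
    _ ≤ ∑ m, ‖V l m * (V⁻¹ *ᵥ fun l => (x l : ℂ)) m‖ := norm_sum_le _ _
    _ = _ := by simp [absMat, absMulVec, Matrix.mulVec, dotProduct]

theorem absMat_nonneg {m n : ℕ} (M : Matrix (Fin m) (Fin n) ℂ) (i : Fin m) (j : Fin n) :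
    0 ≤ absMat M i j := norm_nonneg (M i j)

theorem metzlerOf_le_Lam (A : Fin N → Matrix (Fin n) (Fin n) ℝ) (V : Matrix (Fin n) (Fin n) ℂ)
    (i : Fin N) (j l : Fin n) : metzlerOf (V⁻¹ * toC (A i) * V) j l ≤ Lam A V j l :=
  le_ciSup (f := fun i => metzlerOf (V⁻¹ * toC (A i) * V) j l) (Set.finite_range _).bddAbove i

theorem isZMatrix_neg_Lam [NeZero N] (A : Fin N → Matrix (Fin n) (Fin n) ℝ)
    (V : Matrix (Fin n) (Fin n) ℂ) : IsZMatrix (-Lam A V) := fun j l hjl => by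
  have h1 := metzlerOf_le_Lam A V 0 j l
  have h2 : 0 ≤ metzlerOf (V⁻¹ * toC (A 0) * V) j l := by simp [metzlerOf, hjl]
  rw [Matrix.neg_apply]
  linarith

theorem absMulVec_le_psi (H : ∀ i, Matrix (Fin n) (Fin (k i)) ℝ)
    (δ : ∀ i, (Fin n → ℝ) → (Fin (k i) → ℝ)) (V : Matrix (Fin n) (Fin n) ℂ) (c : Fin n → ℝ)
    (i : Fin N) {ω : Fin (k i) → ℝ} (hω : ∀ l, |ω l| ≤ δ i (absMat V *ᵥ c) l) (j : Fin n) :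
    absMulVec (V⁻¹ * toC (H i)) ω j ≤ psi H δ V c j := by
  refine le_trans ?_ (le_ciSup (f := fun i : Fin N =>
    sSup ((fun w : Fin (k i) → ℝ => absMulVec (V⁻¹ * toC (H i)) w j) ''
      {w | ∀ l, |w l| ≤ δ i (absMat V *ᵥ c) l})) (Set.finite_range _).bddAbove i)
  refine le_csSup ?_ ⟨ω, hω, rfl⟩
  have hbox : {w : Fin (k i) → ℝ | ∀ l, |w l| ≤ δ i (absMat V *ᵥ c) l}
      = Set.Icc (-δ i (absMat V *ᵥ c)) (δ i (absMat V *ᵥ c)) := by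
    ext w
    simp only [Set.mem_ofPred_eq, abs_le, Set.mem_Icc, Pi.le_def, Pi.neg_apply]
    exact forall_and
  rw [hbox]
  have hc : Continuous fun w : Fin (k i) → ℝ => absMulVec (V⁻¹ * toC (H i)) w j :=
    (rowFunctional (V⁻¹ * toC (H i)) j).continuous.norm
  exact (isCompact_Icc.image hc).bddAbove

theorem re_star_mul_le_metzlerOf (B : Matrix (Fin n) (Fin n) ℂ) (z : Fin n → ℂ) (j : Fin n) :
    (star (z j) * (B *ᵥ z) j).re ≤ ‖z j‖ * (metzlerOf B *ᵥ fun l => ‖z l‖) j := by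
  rw [Matrix.mulVec, dotProduct, Matrix.mulVec, dotProduct, Finset.mul_sum, Finset.mul_sum,
    Complex.re_sum]
  refine Finset.sum_le_sum fun l _ => ?_
  by_cases hjl : j = l
  · subst hjl
    have h1 : star (z j) * (B j j * z j) = B j j * ((‖z j‖ ^ 2 : ℝ) : ℂ) := by
      have := Complex.conj_mul' (z j)
      rw [Complex.ofReal_pow, ← this, starRingEnd_apply]; ring
    rw [h1, Complex.re_mul_ofReal]
    simp only [metzlerOf, Matrix.of_apply, if_true]
    apply le_of_eq; ring
  · refine (Complex.re_le_norm _).trans ?_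
    simp [metzlerOf, hjl]

/-- The derivative of `‖z j‖²`, `z = V⁻¹ ξ`, in mode `i` with perturbation `ω`. -/
theorem re_star_mul_le_Lam_psi (A : Fin N → Matrix (Fin n) (Fin n) ℝ)
    (H : ∀ i, Matrix (Fin n) (Fin (k i)) ℝ)
    (δ : ∀ i, (Fin n → ℝ) → (Fin (k i) → ℝ)) {V : Matrix (Fin n) (Fin n) ℂ} (hV : IsUnit V)
    (c ξ : Fin n → ℝ) (i : Fin N) {ω : Fin (k i) → ℝ}
    (hω : ∀ l, |ω l| ≤ δ i (absMat V *ᵥ c) l) (j : Fin n) :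
    (star (rowFunctional V⁻¹ j ξ) * rowFunctional V⁻¹ j (A i *ᵥ ξ + H i *ᵥ ω)).re
      ≤ absMulVec V⁻¹ ξ j * ((Lam A V *ᵥ absMulVec V⁻¹ ξ) j + psi H δ V c j) := by
  have hdet := (Matrix.isUnit_iff_isUnit_det _).1 hV
  set z : Fin n → ℂ := V⁻¹ *ᵥ fun l => (ξ l : ℂ) with hz
  have hz' : rowFunctional V⁻¹ j ξ = z j := rfl
  have h1 : rowFunctional V⁻¹ j (A i *ᵥ ξ) = ((V⁻¹ * toC (A i) * V) *ᵥ z) j := by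
    rw [rowFunctional_apply, ← toC_mulVec, hz, Matrix.mulVec_mulVec, Matrix.mulVec_mulVec,
      mul_assoc _ V, Matrix.mul_nonsing_inv _ hdet, mul_one]
  have h2 : rowFunctional V⁻¹ j (H i *ᵥ ω) = rowFunctional (V⁻¹ * toC (H i)) j ω := by
    rw [rowFunctional_apply, rowFunctional_apply, ← toC_mulVec, Matrix.mulVec_mulVec]
  rw [map_add, mul_add, Complex.add_re, mul_add, h1, h2, hz']
  refine add_le_add ?_ ?_
  · refine (re_star_mul_le_metzlerOf _ z j).trans ?_
    refine mul_le_mul_of_nonneg_left ?_ (norm_nonneg _)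
    change ∑ l, _ * ‖z l‖ ≤ ∑ l, _ * ‖z l‖
    exact Finset.sum_le_sum fun l _ =>
      mul_le_mul_of_nonneg_right (metzlerOf_le_Lam A V i j l) (norm_nonneg (z l))
  · refine (Complex.re_le_norm _).trans ?_
    rw [norm_mul, norm_star]
    exact mul_le_mul_of_nonneg_left (absMulVec_le_psi H δ V c i hω j) (norm_nonneg _)

end Algebra

/-! ### Trajectories -/

section Trajectories

variable {n N : ℕ} {k : Fin N → ℕ} {A : Fin N → Matrix (Fin n) (Fin n) ℝ}
  {H : ∀ i, Matrix (Fin n) (Fin (k i)) ℝ} {δ : ∀ i, (Fin n → ℝ) → (Fin (k i) → ℝ)} {τ : ℝ}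
  {V : Matrix (Fin n) (Fin n) ℂ} {σ : ℝ → Fin N} {w : ∀ i, ℝ → (Fin (k i) → ℝ)}
  {x : ℝ → Fin n → ℝ}

/-- The derivative of `|(V⁻¹ x) j|²` along a trajectory. -/
noncomputable def sqDeriv (A : Fin N → Matrix (Fin n) (Fin n) ℝ)
    (H : ∀ i, Matrix (Fin n) (Fin (k i)) ℝ) (V : Matrix (Fin n) (Fin n) ℂ)
    (σ : ℝ → Fin N) (w : ∀ i, ℝ → (Fin (k i) → ℝ)) (x : ℝ → Fin n → ℝ) (t : ℝ) (j : Fin n) : ℝ :=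
  2 * (star (rowFunctional V⁻¹ j (x t)) * rowFunctional V⁻¹ j (rhs A H σ w x t)).re

theorem SwitchSys.IsTrajectory.intervalIntegrable (h : IsTrajectory A H δ τ σ w x) {s t : ℝ}
    (hs : 0 ≤ s) (hst : s ≤ t) : IntervalIntegrable (rhs A H σ w x) volume s t :=
  (h.integrable s hs).symm.trans (h.integrable t (hs.trans hst))

theorem SwitchSys.IsTrajectory.eq_add_integral (h : IsTrajectory A H δ τ σ w x) {s t : ℝ}
    (hs : 0 ≤ s) (hst : s ≤ t) : x t = x s + ∫ v in s..t, rhs A H σ w x v := by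
  rw [h.solves t (hs.trans hst), h.solves s hs, add_assoc,
    intervalIntegral.integral_add_adjacent_intervals (h.integrable s hs)
      (h.intervalIntegrable hs hst)]

theorem SwitchSys.IsTrajectory.sq_sub_sq (h : IsTrajectory A H δ τ σ w x)
    (V : Matrix (Fin n) (Fin n) ℂ) (j : Fin n) {s t : ℝ} (hs : 0 ≤ s) (hst : s ≤ t) :
    IntervalIntegrable (fun v => sqDeriv A H V σ w x v j) volume s t ∧
      absMulVec V⁻¹ (x t) j ^ 2 - absMulVec V⁻¹ (x s) j ^ 2
        = ∫ v in s..t, sqDeriv A H V σ w x v j := by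
  have hi : ∀ u, s ≤ u →
      IntervalIntegrable (fun v => rowFunctional V⁻¹ j (rhs A H σ w x v)) volume s u :=
    fun u hu => ⟨(rowFunctional V⁻¹ j).integrable_comp (h.intervalIntegrable hs hu).1,
      (rowFunctional V⁻¹ j).integrable_comp (h.intervalIntegrable hs hu).2⟩
  refine norm_sq_sub_norm_sq_eq_integral (z := fun v => rowFunctional V⁻¹ j (x v)) hst (hi t hst)
    fun u hu => ?_
  rw [ContinuousLinearMap.intervalIntegral_comp_comm _ (h.intervalIntegrable hs hu.1), ← map_add,
    ← h.eq_add_integral hs hu.1]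

theorem theta_nonneg (τ : ℝ) (x : ℝ → Fin n → ℝ) (t : ℝ) : 0 ≤ theta τ x t := fun _ =>
  Real.sSup_nonneg (by rintro _ ⟨s, -, rfl⟩; exact abs_nonneg _)

theorem theta_le (hτ : 0 ≤ τ) (hV : IsUnit V) {t : ℝ} {c : Fin n → ℝ}
    (hc : ∀ s ∈ Set.Icc (t - τ) t, absMulVec V⁻¹ (x s) ≤ c) :
    theta τ x t ≤ absMat V *ᵥ c := by
  intro l
  refine csSup_le ⟨_, ⟨t, ⟨by linarith, le_rfl⟩, rfl⟩⟩ ?_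
  rintro _ ⟨s, hs, rfl⟩
  exact (abs_le_absMat_mulVec hV (x s) l).trans
    (mulVec_mono_of_nonneg (absMat_nonneg V) (hc s hs) l)

theorem SwitchSys.IsTrajectory.sqDeriv_le (h : IsTrajectory A H δ τ σ w x) (hτ : 0 ≤ τ)
    (hδ : ∀ i, IsCNI (δ i)) (hV : IsUnit V) {t : ℝ} (ht : 0 ≤ t) {c : Fin n → ℝ}
    (hc : ∀ s ∈ Set.Icc (t - τ) t, absMulVec V⁻¹ (x s) ≤ c) (j : Fin n) :
    sqDeriv A H V σ w x t j ≤ 2 * (absMulVec V⁻¹ (x t) j *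
      ((Lam A V *ᵥ absMulVec V⁻¹ (x t)) j + psi H δ V c j)) := by
  refine mul_le_mul_of_nonneg_left ?_ zero_le_two
  refine re_star_mul_le_Lam_psi A H δ hV c (x t) (σ t) (fun l => ?_) j
  exact (h.bound _ t ht l).trans
    ((hδ _).mono _ _ (theta_nonneg τ x t) (theta_le hτ hV hc) l)

theorem SwitchSys.IsTrajectory.delayIneq (h : IsTrajectory A H δ τ σ w x) (hτ : 0 ≤ τ)
    (hδ : ∀ i, IsCNI (δ i)) (hV : IsUnit V) {F : Matrix (Fin n) (Fin n) ℝ} {d : Fin n → ℝ}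
    {T : ℝ} (hT : 0 ≤ T)
    (hψ : ∀ t, T ≤ t → ∀ c, (∀ s ∈ Set.Icc (t - τ) t, absMulVec V⁻¹ (x s) ≤ c) →
      ∃ c', (∀ s ∈ Set.Icc (t - τ) t, absMulVec V⁻¹ (x s) ≤ c') ∧ psi H δ V c' ≤ F *ᵥ c + d) :
    DelayIneq (Lam A V) F d τ T (fun t => absMulVec V⁻¹ (x t)) (sqDeriv A H V σ w x) where
  nonneg t := absMulVec_nonneg _ _
  cont := by
    refine continuousOn_pi.2 fun j => ?_
    exact ((rowFunctional V⁻¹ j).continuous.norm.comp_continuousOn h.cont).mono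
      (Set.Ici_subset_Ici.2 (by linarith))
  integrable j s t hs hst := (h.sq_sub_sq V j (hT.trans hs) hst).1
  sq_sub_sq j s t hs hst := (h.sq_sub_sq V j (hT.trans hs) hst).2
  le t ht c hc j := by
    obtain ⟨c', hc', hle⟩ := hψ t ht c hc
    refine (h.sqDeriv_le hτ hδ hV (hT.trans ht) hc' j).trans ?_
    refine mul_le_mul_of_nonneg_left (mul_le_mul_of_nonneg_left ?_ (absMulVec_nonneg _ _ _))
      zero_le_two
    exact add_le_add le_rfl (hle j)

theorem limsupLe_of_eventually {v : ℝ → Fin n → ℝ} {b : Fin n → ℝ}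
    (h : ∀ j, ∀ ε : ℝ, 0 < ε → ∀ᶠ t in atTop, v t j ≤ b j + ε) : LimsupLe v b := by
  intro j
  refine EReal.le_of_forall_lt_iff_le.1 fun a ha => ?_
  rw [EReal.coe_lt_coe_iff] at ha
  refine limsup_le_of_le (by isBoundedDefault) ?_
  filter_upwards [h j (a - b j) (sub_pos.2 ha)] with t ht
  rw [EReal.coe_le_coe_iff]
  linarith

end Trajectories

/-! ### Iterates of `T₀` -/

section Iterates

variable {n : ℕ} {Λ F : Matrix (Fin n) (Fin n) ℝ} {wbar : Fin n → ℝ}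
  {δ' : (Fin n → ℝ) → (Fin n → ℝ)}

theorem mulVec_Tzero (hΛ : IsHurwitz Λ) (δ' : (Fin n → ℝ) → (Fin n → ℝ)) (c : Fin n → ℝ) :
    Λ *ᵥ Tzero Λ δ' c = -δ' c := by
  rw [Tzero, Matrix.mulVec_mulVec, mul_neg, Matrix.mul_nonsing_inv _ hΛ.isUnit_det_self,
    Matrix.neg_mulVec, Matrix.one_mulVec]

theorem Tzero_nonneg (hΛ : IsHurwitz Λ) (hZ : IsZMatrix (-Λ)) (hδ' : IsCNI δ') {c : Fin n → ℝ}
    (hc : 0 ≤ c) : 0 ≤ Tzero Λ δ' c :=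
  mulVec_nonneg_of_nonneg (hΛ.neg_inv_nonneg hZ) (hδ'.nonneg c hc)

theorem Tzero_mono (hΛ : IsHurwitz Λ) (hZ : IsZMatrix (-Λ)) (hδ' : IsCNI δ') {c c' : Fin n → ℝ}
    (hc : 0 ≤ c) (hcc' : c ≤ c') : Tzero Λ δ' c ≤ Tzero Λ δ' c' :=
  mulVec_mono_of_nonneg (hΛ.neg_inv_nonneg hZ) (hδ'.mono c c' hc hcc')

theorem Tzero_bTilde_le (hΛ : IsHurwitz Λ) (hZ : IsZMatrix (-Λ))
    (hρ : specRad (Rmat Λ F) < 1)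
    (hle : δ' (bTilde Λ F wbar) ≤ F *ᵥ bTilde Λ F wbar + wbar) :
    Tzero Λ δ' (bTilde Λ F wbar) ≤ bTilde Λ F wbar := by
  refine (mulVec_mono_of_nonneg (hΛ.neg_inv_nonneg hZ) hle).trans (le_of_eq ?_)
  have h := add_mulVec_bTilde hΛ hρ wbar
  rw [add_eq_zero_iff_neg_eq] at h
  rw [← h, Matrix.mulVec_neg, Matrix.neg_mulVec, neg_neg, Matrix.mulVec_mulVec,
    Matrix.nonsing_inv_mul _ hΛ.isUnit_det_self, Matrix.one_mulVec]

/-- The iterates of a monotone self-map of the orthant, from a point mapped below itself, are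
nonnegative and decrease. -/
theorem iterate_nonneg_antitone {f : (Fin n → ℝ) → (Fin n → ℝ)} (hf : IsCNI f) {a : Fin n → ℝ}
    (ha : 0 ≤ a) (hfa : f a ≤ a) : (∀ m, 0 ≤ f^[m] a) ∧ Antitone fun m => f^[m] a := by
  have hnn : ∀ m, 0 ≤ f^[m] a := fun m => by
    induction m with
    | zero => exact ha
    | succ m ih => rw [Function.iterate_succ_apply']; exact hf.nonneg _ ih
  refine ⟨hnn, antitone_nat_of_succ_le fun m => ?_⟩
  induction m with
  | zero => exact hfa
  | succ m ih =>
    rw [Function.iterate_succ_apply' f (m + 1), Function.iterate_succ_apply' f m]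
    refine hf.mono _ _ ?_ ?_
    · rw [← Function.iterate_succ_apply' f m]; exact hnn _
    · rw [← Function.iterate_succ_apply' f m]; exact ih

theorem exists_tendsto_of_antitone_of_nonneg {a : ℕ → Fin n → ℝ} (hnn : ∀ m, 0 ≤ a m)
    (ha : Antitone a) : ∃ b, Tendsto a atTop (𝓝 b) ∧ ∀ m, b ≤ a m := by
  refine ⟨fun j => ⨅ m, a m j, tendsto_pi_nhds.2 fun j => ?_, fun m j => ?_⟩
  · exact tendsto_atTop_ciInf (fun m m' h => ha h j) ⟨0, by rintro _ ⟨m, rfl⟩; exact hnn m j⟩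
  · exact ciInf_le ⟨0, by rintro _ ⟨m, rfl⟩; exact hnn m j⟩ m

end Iterates

section UltimateBound

variable {n N : ℕ} [NeZero N] {k : Fin N → ℕ} {A : Fin N → Matrix (Fin n) (Fin n) ℝ}
  {H : ∀ i, Matrix (Fin n) (Fin (k i)) ℝ} {δ : ∀ i, (Fin n → ℝ) → (Fin (k i) → ℝ)} {τ : ℝ}
  {V : Matrix (Fin n) (Fin n) ℂ} {σ : ℝ → Fin N} {w : ∀ i, ℝ → (Fin (k i) → ℝ)}
  {x : ℝ → Fin n → ℝ}

/-- If all components are ultimately below every `a + ε`, they are below every `T₀ a + ε`. -/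
theorem SwitchSys.IsTrajectory.eventually_le_Tzero (h : IsTrajectory A H δ τ σ w x) (hτ : 0 ≤ τ)
    (hδ : ∀ i, IsCNI (δ i)) (hV : IsUnit V) (hΛ : IsHurwitz (Lam A V))
    {δ' : (Fin n → ℝ) → (Fin n → ℝ)} (hcont : ContinuousOn δ' (Set.Ici 0)) (hδ' : IsCNI δ')
    (hψ : ∀ c : Fin n → ℝ, 0 ≤ c → psi H δ V c ≤ δ' c) {a : Fin n → ℝ} (ha : 0 ≤ a)
    (hev : ∀ j, ∀ ε : ℝ, 0 < ε → ∀ᶠ t in atTop, absMulVec V⁻¹ (x t) j ≤ a j + ε) (j : Fin n)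
    (ε : ℝ) (hε : 0 < ε) :
    ∀ᶠ t in atTop, absMulVec V⁻¹ (x t) j ≤ Tzero (Lam A V) δ' a j + ε := by
  have hZ := isZMatrix_neg_Lam A V
  obtain ⟨κ, hκ, hκlt⟩ : ∃ κ : ℝ, 0 < κ ∧
      Tzero (Lam A V) δ' (a + fun _ => κ) j < Tzero (Lam A V) δ' a j + ε / 2 := by
    have h1 : ContinuousOn (fun c => Tzero (Lam A V) δ' c j) (Set.Ici 0) := by
      have h2 : Continuous fun y : Fin n → ℝ => ((-(Lam A V)⁻¹) *ᵥ y) j :=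
        (continuous_apply j).comp (continuous_const.matrix_mulVec continuous_id)
      exact h2.comp_continuousOn hcont
    have h3 : Tendsto (fun κ : ℝ => a + fun _ => κ) (𝓝[>] 0) (𝓝[Set.Ici 0] a) := by
      refine tendsto_nhdsWithin_iff.2 ⟨?_, ?_⟩
      · have : Continuous fun κ : ℝ => a + fun _ : Fin n => κ := by fun_prop
        have h4 := (this.tendsto 0).mono_left (nhdsWithin_le_nhds (s := Set.Ioi 0))
        convert h4 using 2
        ext; simp
      · filter_upwards [self_mem_nhdsWithin] with κ hκ i
        exact add_nonneg (ha i) (le_of_lt hκ)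
    have h5 := ((h1 a ha).tendsto.comp h3).eventually
      (gt_mem_nhds (show Tzero (Lam A V) δ' a j < Tzero (Lam A V) δ' a j + ε / 2 by linarith))
    obtain ⟨κ, hκ1, hκ2⟩ := (h5.and self_mem_nhdsWithin).exists
    exact ⟨κ, hκ2, hκ1⟩
  set c : Fin n → ℝ := a + fun _ => κ with hc
  have hcnn : 0 ≤ c := add_nonneg ha fun _ => hκ.le
  obtain ⟨T₁, hT₁⟩ := eventually_atTop.1 (eventually_all.2 fun i => hev i κ hκ)
  obtain ⟨η, hη, hη1⟩ := hΛ.exists_pos hZ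
  have hD := h.delayIneq (F := 0) (d := δ' c) (T := max T₁ 0 + τ) hτ hδ hV (by positivity)
    fun t ht _ _ => ⟨c, fun s hs => hT₁ s (by linarith [hs.1, le_max_left T₁ 0]), by
      rw [Matrix.zero_mulVec, zero_add]; exact hψ c hcnn⟩
  have h1 := hD.eventually_le_add (b := Tzero (Lam A V) δ' c) hτ hZ (Tzero_nonneg hΛ hZ hδ' hcnn)
    (by rw [mulVec_Tzero hΛ, Matrix.zero_mulVec]; simp) hη
    (fun i => by
      have := congrFun hη1 i
      rw [Matrix.neg_mulVec] at this
      simp only [Pi.neg_apply, Pi.one_apply] at this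
      rw [Matrix.zero_mulVec, Pi.zero_apply]
      linarith) j (half_pos hε)
  filter_upwards [h1] with t ht
  linarith

end UltimateBound

/-! ### The quadratic Lyapunov function -/

section Lyapunov

variable {n N : ℕ} {k : Fin N → ℕ} {A : Fin N → Matrix (Fin n) (Fin n) ℝ}
  {H : ∀ i, Matrix (Fin n) (Fin (k i)) ℝ} {δ : ∀ i, (Fin n → ℝ) → (Fin (k i) → ℝ)}
  {V : Matrix (Fin n) (Fin n) ℂ} {D : Matrix (Fin n) (Fin n) ℝ}

theorem dotProduct_Pmat_mulVec (V : Matrix (Fin n) (Fin n) ℂ) (hD : D.IsDiag) (ξ y : Fin n → ℝ) :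
    ξ ⬝ᵥ (Pmat V D *ᵥ y)
      = ∑ j, D j j * (star (rowFunctional V⁻¹ j ξ) * rowFunctional V⁻¹ j y).re := by
  have h1 : ξ ⬝ᵥ (Pmat V D *ᵥ y)
      = (star (fun l => (ξ l : ℂ)) ⬝ᵥ (((V⁻¹)ᴴ * toC D * V⁻¹) *ᵥ fun l => (y l : ℂ))).re := by
    simp only [dotProduct, Matrix.mulVec, Complex.re_sum, Pi.star_apply, Pmat, Matrix.map_apply]
    refine Finset.sum_congr rfl fun i _ => ?_
    have : star (ξ i : ℂ) = (ξ i : ℂ) := Complex.conj_ofReal _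
    rw [this, Complex.re_ofReal_mul, Complex.re_sum]
    simp only [Complex.re_mul_ofReal]
  rw [h1, ← Matrix.mulVec_mulVec, ← Matrix.mulVec_mulVec, Matrix.dotProduct_mulVec,
    ← Matrix.star_mulVec]
  have h2 : toC D = Matrix.diagonal fun j => (D j j : ℂ) := by
    ext i j
    by_cases hij : i = j
    · subst hij; simp
    · simp [hij, hD hij]
  rw [h2]
  simp only [dotProduct, Complex.re_sum, Matrix.mulVec_diagonal, Pi.star_apply]
  refine Finset.sum_congr rfl fun j _ => ?_
  rw [← rowFunctional_apply, ← rowFunctional_apply, mul_left_comm, Complex.re_ofReal_mul]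

theorem quadForm_Pmat (V : Matrix (Fin n) (Fin n) ℂ) (hD : D.IsDiag) (ξ : Fin n → ℝ) :
    quadForm (Pmat V D) ξ = ∑ j, D j j * absMulVec V⁻¹ ξ j ^ 2 := by
  rw [quadForm, dotProduct_Pmat_mulVec V hD]
  refine Finset.sum_congr rfl fun j _ => ?_
  have : star (rowFunctional V⁻¹ j ξ) * rowFunctional V⁻¹ j ξ
      = ((absMulVec V⁻¹ ξ j ^ 2 : ℝ) : ℂ) := by
    rw [absMulVec_eq_norm, Complex.ofReal_pow]
    exact Complex.conj_mul' _
  rw [this, Complex.ofReal_re]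

theorem lyapunov_derivative_eq (V : Matrix (Fin n) (Fin n) ℂ) (hD : D.IsDiag)
    (B : Matrix (Fin n) (Fin n) ℝ) (ξ v : Fin n → ℝ) :
    ξ ⬝ᵥ ((Bᵀ * Pmat V D + Pmat V D * B) *ᵥ ξ) + 2 * (ξ ⬝ᵥ (Pmat V D *ᵥ v))
      = ∑ j, D j j * (2 * (star (rowFunctional V⁻¹ j ξ) *
          rowFunctional V⁻¹ j (B *ᵥ ξ + v)).re) := by
  have h1 : ξ ⬝ᵥ ((Bᵀ * Pmat V D) *ᵥ ξ) = ξ ⬝ᵥ ((Pmat V D * B) *ᵥ ξ) := by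
    rw [← Matrix.mulVec_mulVec, ← Matrix.mulVec_mulVec, Matrix.dotProduct_mulVec,
      Matrix.vecMul_transpose, dotProduct_Pmat_mulVec V hD, dotProduct_Pmat_mulVec V hD]
    refine Finset.sum_congr rfl fun j _ => ?_
    rw [← Complex.conj_re, ← starRingEnd_apply, map_mul, starRingEnd_apply, starRingEnd_apply,
      star_star, starRingEnd_apply, mul_comm (star (rowFunctional V⁻¹ j ξ))]
  rw [Matrix.add_mulVec, dotProduct_add, h1, ← Matrix.mulVec_mulVec,
    dotProduct_Pmat_mulVec V hD, dotProduct_Pmat_mulVec V hD, Finset.mul_sum,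
    ← Finset.sum_add_distrib, ← Finset.sum_add_distrib]
  refine Finset.sum_congr rfl fun j _ => ?_
  rw [map_add, mul_add, Complex.add_re]
  ring

theorem exists_pos_mul_norm_sq_le {Q : Matrix (Fin n) (Fin n) ℝ} (hQ : Q.PosDef) :
    ∃ q : ℝ, 0 < q ∧ ∀ u : Fin n → ℝ, q * ‖u‖ ^ 2 ≤ u ⬝ᵥ (Q *ᵥ u) := by
  have hpos : ∀ u : Fin n → ℝ, u ≠ 0 → 0 < u ⬝ᵥ (Q *ᵥ u) := fun u hu => by
    simpa using hQ.dotProduct_mulVec_pos hu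
  have hcont : Continuous fun u : Fin n → ℝ => u ⬝ᵥ (Q *ᵥ u) :=
    continuous_id.dotProduct (continuous_const.matrix_mulVec continuous_id)
  obtain ⟨q, hq, hqle⟩ : ∃ q : ℝ, 0 < q ∧
      ∀ v ∈ Metric.sphere (0 : Fin n → ℝ) 1, q ≤ v ⬝ᵥ (Q *ᵥ v) := by
    rcases (Metric.sphere (0 : Fin n → ℝ) 1).eq_empty_or_nonempty with he | hne
    · exact ⟨1, one_pos, by simp [he]⟩
    · obtain ⟨v, hv, hmin⟩ :=
        (isCompact_sphere (0 : Fin n → ℝ) 1).exists_isMinOn hne hcont.continuousOn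
      exact ⟨_, hpos v (Metric.ne_of_mem_sphere hv one_ne_zero), fun y hy => hmin hy⟩
  refine ⟨q, hq, fun u => ?_⟩
  by_cases hu : u = 0
  · simp [hu]
  have hn : 0 < ‖u‖ := norm_pos_iff.2 hu
  have h1 := hqle (‖u‖⁻¹ • u) (by simp [norm_smul, hn.ne'])
  rw [Matrix.mulVec_smul, smul_dotProduct, dotProduct_smul, smul_eq_mul, smul_eq_mul] at h1
  calc q * ‖u‖ ^ 2 ≤ (‖u‖⁻¹ * (‖u‖⁻¹ * (u ⬝ᵥ (Q *ᵥ u)))) * ‖u‖ ^ 2 :=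
        mul_le_mul_of_nonneg_right h1 (sq_nonneg _)
    _ = _ := by field_simp

theorem SwitchSys.IsDiagLyap.diag_pos {M : Matrix (Fin n) (Fin n) ℝ} (hD : IsDiagLyap M D)
    (j : Fin n) : 0 < D j j := hD.2.1.diag_pos

theorem SwitchSys.IsDiagLyap.dotProduct_eq {M : Matrix (Fin n) (Fin n) ℝ} (hD : IsDiagLyap M D)
    (u : Fin n → ℝ) :
    ∑ j, D j j * (2 * (u j * (M *ᵥ u) j)) = -(u ⬝ᵥ (-(Mᵀ * D + D * M) *ᵥ u)) := by
  have hdiag : D = Matrix.diagonal fun j => D j j := hD.1.diagonal_diag.symm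
  have h1 : u ⬝ᵥ ((D * M) *ᵥ u) = ∑ j, D j j * (u j * (M *ᵥ u) j) := by
    rw [← Matrix.mulVec_mulVec, dotProduct]
    refine Finset.sum_congr rfl fun j _ => ?_
    conv_lhs => rw [hdiag]
    rw [Matrix.mulVec_diagonal]; ring
  have h2 : u ⬝ᵥ ((Mᵀ * D) *ᵥ u) = ∑ j, D j j * (u j * (M *ᵥ u) j) := by
    rw [← Matrix.mulVec_mulVec, Matrix.dotProduct_mulVec, Matrix.vecMul_transpose, dotProduct]
    refine Finset.sum_congr rfl fun j _ => ?_
    conv_lhs => rw [hdiag]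
    rw [Matrix.mulVec_diagonal]; ring
  rw [Matrix.neg_mulVec, dotProduct_neg, neg_neg, Matrix.add_mulVec, dotProduct_add, h1, h2,
    ← Finset.sum_add_distrib]
  exact Finset.sum_congr rfl fun j _ => by ring

/-- Outside a ball, the derivative of the Lyapunov function is at most `-1`. -/
theorem exists_lyapunov_derivative_le (hδ : ∀ i, IsCNI (δ i)) (hV : IsUnit V)
    {F : Matrix (Fin n) (Fin n) ℝ} {wbar : Fin n → ℝ} (hw : 0 ≤ wbar)
    (hψ : ∀ x : Fin n → ℝ, 0 ≤ x → psi H δ V x ≤ F *ᵥ x + wbar)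
    (hD : IsDiagLyap (Lam A V + F) D) :
    ∃ r : ℝ, ∀ i, ∀ ξ : Fin n → ℝ, ∀ ω : Fin (k i) → ℝ,
      (∀ l, |ω l| ≤ δ i (fun j => |ξ j|) l) → r < ‖WithLp.toLp 2 ξ‖ →
      ∑ j, D j j * (2 * (star (rowFunctional V⁻¹ j ξ) *
          rowFunctional V⁻¹ j (A i *ᵥ ξ + H i *ᵥ ω)).re) ≤ -1 := by
  obtain ⟨q, hq, hqle⟩ := exists_pos_mul_norm_sq_le hD.2.2
  set K : ℝ := ∑ j, D j j * (2 * wbar j) with hK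
  have hKnn : 0 ≤ K := Finset.sum_nonneg fun j _ =>
    mul_nonneg (hD.diag_pos j).le (mul_nonneg zero_le_two (hw j))
  set ρ₀ : ℝ := (K + 1) / q + 1 with hρ₀
  set e : (Fin n → ℝ) →L[ℝ] EuclideanSpace ℝ (Fin n) :=
    ((PiLp.continuousLinearEquiv 2 ℝ fun _ : Fin n => ℝ).symm :
      (Fin n → ℝ) →L[ℝ] EuclideanSpace ℝ (Fin n))
  have hnorm : ∀ ξ : Fin n → ℝ, ‖ξ‖ ≤ (∑ l, ∑ m, absMat V l m) * ‖absMulVec V⁻¹ ξ‖ := by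
    intro ξ
    have hS : ∀ l, 0 ≤ ∑ m, absMat V l m := fun l =>
      Finset.sum_nonneg fun m _ => absMat_nonneg V l m
    refine (pi_norm_le_iff_of_nonneg (mul_nonneg (Finset.sum_nonneg fun l _ => hS l)
      (norm_nonneg _))).2 fun l => ?_
    calc ‖ξ l‖ ≤ ∑ m, absMat V l m * absMulVec V⁻¹ ξ m := abs_le_absMat_mulVec hV ξ l
      _ ≤ ∑ m, absMat V l m * ‖absMulVec V⁻¹ ξ‖ := Finset.sum_le_sum fun m _ =>
        mul_le_mul_of_nonneg_left ((le_abs_self _).trans (norm_le_pi_norm (absMulVec V⁻¹ ξ) m))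
          (absMat_nonneg V l m)
      _ = (∑ m, absMat V l m) * ‖absMulVec V⁻¹ ξ‖ := by rw [Finset.sum_mul]
      _ ≤ _ := mul_le_mul_of_nonneg_right
        (Finset.single_le_sum (f := fun l => ∑ m, absMat V l m) (fun l _ => hS l)
          (Finset.mem_univ l)) (norm_nonneg _)
  refine ⟨‖e‖ * ((∑ l, ∑ m, absMat V l m) * ρ₀), fun i ξ ω hω hr => ?_⟩
  set u := absMulVec V⁻¹ ξ with hu
  have hunn : 0 ≤ u := absMulVec_nonneg _ _
  have hularge : ρ₀ < ‖u‖ := by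
    by_contra hle
    refine absurd hr (not_lt.2 ?_)
    calc ‖WithLp.toLp 2 ξ‖ = ‖e ξ‖ := rfl
      _ ≤ ‖e‖ * ‖ξ‖ := e.le_opNorm ξ
      _ ≤ _ := mul_le_mul_of_nonneg_left ((hnorm ξ).trans
        (mul_le_mul_of_nonneg_left (not_lt.1 hle)
          (Finset.sum_nonneg fun l _ => Finset.sum_nonneg fun m _ => absMat_nonneg V l m)))
        (norm_nonneg _)
  have hω' : ∀ l, |ω l| ≤ δ i (absMat V *ᵥ u) l := fun l => (hω l).trans
    ((hδ i).mono _ _ (fun j => abs_nonneg (ξ j)) (fun j => abs_le_absMat_mulVec hV ξ j) l)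
  calc ∑ j, D j j * (2 * (star (rowFunctional V⁻¹ j ξ) *
          rowFunctional V⁻¹ j (A i *ᵥ ξ + H i *ᵥ ω)).re)
      ≤ ∑ j, (D j j * (2 * (u j * ((Lam A V + F) *ᵥ u) j)) + D j j * (2 * wbar j) * ‖u‖) := by
        refine Finset.sum_le_sum fun j _ => ?_
        have h1 := re_star_mul_le_Lam_psi A H δ hV u ξ i hω' j
        have h2 := mul_le_mul_of_nonneg_left (hψ u hunn j) (hunn j)
        have h3 : u j * wbar j ≤ ‖u‖ * wbar j := mul_le_mul_of_nonneg_right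
          ((le_abs_self _).trans (norm_le_pi_norm u j)) (hw j)
        have h4 : (star (rowFunctional V⁻¹ j ξ) *
            rowFunctional V⁻¹ j (A i *ᵥ ξ + H i *ᵥ ω)).re
            ≤ u j * ((Lam A V + F) *ᵥ u) j + ‖u‖ * wbar j := by
          rw [Matrix.add_mulVec, Pi.add_apply]
          simp only [Pi.add_apply] at h2
          linarith
        have h5 := mul_le_mul_of_nonneg_left h4 (mul_nonneg (hD.diag_pos j).le zero_le_two)
        linarith
    _ = -(u ⬝ᵥ (-((Lam A V + F)ᵀ * D + D * (Lam A V + F)) *ᵥ u)) + K * ‖u‖ := by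
        rw [Finset.sum_add_distrib, hD.dotProduct_eq, ← Finset.sum_mul]
    _ ≤ -(q * ‖u‖ ^ 2) + K * ‖u‖ := by linarith [hqle u]
    _ ≤ -1 := by
        have h1 : (K + 1) / q ≤ ‖u‖ := by linarith
        rw [div_le_iff₀ hq] at h1
        have h2 : 1 ≤ ‖u‖ := by
          have : 0 ≤ (K + 1) / q := by positivity
          linarith
        have h3 := mul_le_mul_of_nonneg_left h1 (norm_nonneg u)
        nlinarith

theorem theta_zero (x : ℝ → Fin n → ℝ) (t : ℝ) : theta 0 x t = fun j => |x t j| := by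
  ext j
  simp [theta]

theorem SwitchSys.IsTrajectory.upperDini_neg {σ : ℝ → Fin N} {w : ∀ i, ℝ → (Fin (k i) → ℝ)}
    {x : ℝ → Fin n → ℝ} (h : IsTrajectory A H δ 0 σ w x) (hD : D.IsDiag) {r : ℝ}
    (hr : ∀ i, ∀ ξ : Fin n → ℝ, ∀ ω : Fin (k i) → ℝ,
      (∀ l, |ω l| ≤ δ i (fun j => |ξ j|) l) → r < ‖WithLp.toLp 2 ξ‖ →
      ∑ j, D j j * (2 * (star (rowFunctional V⁻¹ j ξ) *
          rowFunctional V⁻¹ j (A i *ᵥ ξ + H i *ᵥ ω)).re) ≤ -1)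
    {t : ℝ} (ht : 0 ≤ t) (hrt : r < ‖WithLp.toLp 2 (x t)‖) :
    upperDini (fun s => quadForm (Pmat V D) (x s)) t < 0 := by
  have hcont : ContinuousWithinAt (fun s => ‖WithLp.toLp 2 (x s)‖) (Set.Ici t) t := by
    have h1 : ContinuousWithinAt x (Set.Ici t) t :=
      (h.cont t (by simpa using ht)).mono (Set.Ici_subset_Ici.2 (by simpa using ht))
    exact (PiLp.continuous_toLp 2 fun _ : Fin n => ℝ).norm.continuousAt.comp_continuousWithinAt h1
  obtain ⟨t₂, ht₂, hIco⟩ := mem_nhdsGE_iff_exists_Ico_subset.1 (hcont.eventually (lt_mem_nhds hrt))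
  have hle : upperDini (fun s => quadForm (Pmat V D) (x s)) t ≤ ((-1 : ℝ) : EReal) := by
    refine limsup_le_of_le (by isBoundedDefault) ?_
    filter_upwards [Ioo_mem_nhdsGT (sub_pos.2 ht₂)] with s hs
    rw [EReal.coe_le_coe_iff, div_le_iff₀ hs.1]
    have hts : t ≤ t + s := by linarith [hs.1]
    have hintegr := fun j => (h.sq_sub_sq V j ht hts).1
    calc quadForm (Pmat V D) (x (t + s)) - quadForm (Pmat V D) (x t)
        = ∑ j, D j j * ∫ v in t..(t + s), sqDeriv A H V σ w x v j := by
          rw [quadForm_Pmat V hD, quadForm_Pmat V hD, ← Finset.sum_sub_distrib]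
          refine Finset.sum_congr rfl fun j _ => ?_
          rw [← (h.sq_sub_sq V j ht hts).2]; ring
      _ = ∫ v in t..(t + s), ∑ j, D j j * sqDeriv A H V σ w x v j := by
          rw [intervalIntegral.integral_finsetSum fun j _ => (hintegr j).const_mul _]
          simp only [intervalIntegral.integral_const_mul]
      _ ≤ ∫ _ in t..(t + s), (-1 : ℝ) := by
          refine intervalIntegral.integral_mono_on hts ?_ intervalIntegrable_const fun v hv => ?_
          · have := IntervalIntegrable.sum Finset.univ
              (f := fun j v => D j j * sqDeriv A H V σ w x v j) fun j _ => (hintegr j).const_mul _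
            rwa [show (∑ j, fun v => D j j * sqDeriv A H V σ w x v j)
              = fun v => ∑ j, D j j * sqDeriv A H V σ w x v j by ext v; simp] at this
          · refine hr (σ v) (x v) (w (σ v) v) (fun l => ?_)
              (hIco ⟨hv.1, by linarith [hv.2, hs.2]⟩)
            have := h.bound (σ v) v (ht.trans hv.1) l
            rwa [theta_zero] at this
      _ = -1 * s := by simp
  exact hle.trans_lt (by exact_mod_cast (by norm_num : (-1 : ℝ) < 0))

end Lyapunov

theorem mainTheorem2 {n N : ℕ} [NeZero N] {k : Fin N → ℕ}
    (A : Fin N → Matrix (Fin n) (Fin n) ℝ) (H : ∀ i, Matrix (Fin n) (Fin (k i)) ℝ)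
    (δ : ∀ i, (Fin n → ℝ) → (Fin (k i) → ℝ))
    (hδ_cont : ∀ i, ContinuousOn (δ i) (Set.Ici 0)) (hδ_cni : ∀ i, IsCNI (δ i))
    (τ : ℝ) (hτ : 0 ≤ τ)
    (V : Matrix (Fin n) (Fin n) ℂ) (hV : IsUnit V)
    (hΛ : IsHurwitz (Lam A V))
    (F : Matrix (Fin n) (Fin n) ℝ) (wbar : Fin n → ℝ)
    (hF : ∀ i j, 0 ≤ F i j) (hw : 0 ≤ wbar)
    (hψ : ∀ x : Fin n → ℝ, 0 ≤ x → psi H δ V x ≤ F *ᵥ x + wbar)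
    (hR : specRad (Rmat (Lam A V) F) < 1) :
    -- the bound is well defined and lies in the nonnegative orthant
    (IsUnit (1 - Rmat (Lam A V) F) ∧ 0 ≤ bTilde (Lam A V) F wbar) ∧
    -- (a) invariance
    (∀ σ w x, IsTrajectory A H δ τ σ w x →
      (∀ t, -τ ≤ t → t ≤ 0 → absMulVec V⁻¹ (x t) ≤ bTilde (Lam A V) F wbar) →
      ∀ t, -τ ≤ t → absMulVec V⁻¹ (x t) ≤ bTilde (Lam A V) F wbar) ∧
    -- (b) global ultimate bound
    (∀ σ w x, IsTrajectory A H δ τ σ w x →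
      LimsupLe (fun t => absMulVec V⁻¹ (x t)) (bTilde (Lam A V) F wbar)) ∧
    -- (c) tighter global ultimate bound
    (∀ δ' : (Fin n → ℝ) → (Fin n → ℝ), ContinuousOn δ' (Set.Ici 0) → IsCNI δ' →
      (∀ x : Fin n → ℝ, 0 ≤ x → psi H δ V x ≤ δ' x ∧ δ' x ≤ F *ᵥ x + wbar) →
      ∃ b : Fin n → ℝ,
        Tendsto (fun m : ℕ => (Tzero (Lam A V) δ')^[m] (bTilde (Lam A V) F wbar)) atTop (𝓝 b) ∧
        b ≤ bTilde (Lam A V) F wbar ∧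
        ∀ σ w x, IsTrajectory A H δ τ σ w x →
          LimsupLe (fun t => absMulVec V⁻¹ (x t)) b) ∧
    -- (d) diagonal Lyapunov matrix
    (∃ D, IsDiagLyap (Lam A V + F) D) ∧
    -- (e) quadratic Lyapunov function in the absence of delay: its derivative is negative outside
    -- a ball, both as the expression `L̇ = x'(A'P + PA)x + 2x'PHw` for every mode, state and
    -- admissible perturbation, and as the upper Dini derivative along every trajectory
    (τ = 0 → ∀ D, IsDiagLyap (Lam A V + F) D →
      ∃ r : ℝ,
        (∀ i, ∀ ξ : Fin n → ℝ, ∀ ω : Fin (k i) → ℝ,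
          (∀ l, |ω l| ≤ δ i (fun j => |ξ j|) l) → r < ‖WithLp.toLp 2 ξ‖ →
          ξ ⬝ᵥ (((A i)ᵀ * Pmat V D + Pmat V D * A i) *ᵥ ξ)
            + 2 * (ξ ⬝ᵥ (Pmat V D *ᵥ (H i *ᵥ ω))) < 0) ∧
        (∀ σ w x, IsTrajectory A H δ τ σ w x → ∀ t, 0 ≤ t → r < ‖WithLp.toLp 2 (x t)‖ →
          upperDini (fun s => quadForm (Pmat V D) (x s)) t < 0)) := by
  have hZ := isZMatrix_neg_Lam A V
  set Λ := Lam A V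
  have hbnn := bTilde_nonneg hΛ hZ hF hR hw
  have hbeq := add_mulVec_bTilde hΛ hR wbar
  have hunit := isUnit_det_one_sub hR
  have hQnn := inv_mul_neg_inv_nonneg hΛ hZ hF hR
  have hMQ := neg_add_mul_inv (F := F) hΛ.isUnit_det_self hunit
  obtain ⟨η, hη, hη1⟩ := (hZ.neg_add hF).exists_pos_of_right_inv hQnn hMQ
  have hηlt : ∀ j, (Λ *ᵥ η) j + (F *ᵥ η) j < 0 := fun j => by
    have := congrFun hη1 j
    rw [Matrix.neg_mulVec, Matrix.add_mulVec] at this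
    simp only [Pi.neg_apply, Pi.add_apply, Pi.one_apply] at this
    linarith
  have hdelay : ∀ σ w x, IsTrajectory A H δ τ σ w x →
      DelayIneq Λ F wbar τ 0 (fun t => absMulVec V⁻¹ (x t)) (sqDeriv A H V σ w x) :=
    fun σ w x h => h.delayIneq hτ hδ_cni hV le_rfl fun t _ c hc =>
      ⟨c, hc, hψ c ((absMulVec_nonneg _ _).trans (hc t ⟨by linarith, le_rfl⟩))⟩
  have hev : ∀ σ w x, IsTrajectory A H δ τ σ w x → ∀ j, ∀ ε : ℝ, 0 < ε →
      ∀ᶠ t in atTop, absMulVec V⁻¹ (x t) j ≤ bTilde Λ F wbar j + ε :=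
    fun σ w x h j ε hε => (hdelay σ w x h).eventually_le_add hτ hZ hbnn hbeq.le hη hηlt j hε
  refine ⟨⟨(Matrix.isUnit_iff_isUnit_det _).2 hunit, hbnn⟩, ?_, ?_, ?_, ?_, ?_⟩
  · intro σ w x h hstart t ht
    rcases le_total t 0 with h0 | h0
    · exact hstart t ht h0
    · exact (hdelay σ w x h).le_of_le hτ hZ hbnn hbeq.le hη hηlt
        (fun s hs => hstart s (by simpa using hs.1) hs.2) h0
  · exact fun σ w x h => limsupLe_of_eventually (hev σ w x h)
  · intro δ' hcont hδ' hle
    have hCNI : IsCNI (Tzero Λ δ') := ⟨fun c hc => Tzero_nonneg hΛ hZ hδ' hc,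
      fun c c' hc hcc' => Tzero_mono hΛ hZ hδ' hc hcc'⟩
    obtain ⟨hnn, hanti⟩ := iterate_nonneg_antitone hCNI hbnn
      (Tzero_bTilde_le hΛ hZ hR (hle _ hbnn).2)
    obtain ⟨b, hlim, hb⟩ := exists_tendsto_of_antitone_of_nonneg hnn hanti
    refine ⟨b, hlim, hb 0, fun σ w x h => limsupLe_of_eventually fun j ε hε => ?_⟩
    have hiter : ∀ m j, ∀ ε : ℝ, 0 < ε → ∀ᶠ t in atTop,
        absMulVec V⁻¹ (x t) j ≤ (Tzero Λ δ')^[m] (bTilde Λ F wbar) j + ε := fun m => by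
      induction m with
      | zero => exact hev σ w x h
      | succ m ih =>
        rw [Function.iterate_succ_apply']
        exact h.eventually_le_Tzero hτ hδ_cni hV hΛ hcont hδ' (fun c hc => (hle c hc).1) (hnn m) ih
    obtain ⟨m, hm⟩ := ((tendsto_pi_nhds.1 hlim j).eventually
      (gt_mem_nhds (show b j < b j + ε / 2 by linarith))).exists
    filter_upwards [hiter m j (ε / 2) (half_pos hε)] with t ht
    linarith
  · exact exists_isDiagLyap (hZ.neg_add hF) hQnn hMQ
  · rintro rfl D hD
    obtain ⟨r, hr⟩ := exists_lyapunov_derivative_le hδ_cni hV hw hψ hD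
    refine ⟨r, fun i ξ ω hω hlarge => ?_, fun σ w x h t ht hlarge =>
      h.upperDini_neg hD.1 hr ht hlarge⟩
    rw [lyapunov_derivative_eq V hD.1]
    linarith [hr i ξ ω hω hlarge]
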